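/- Let $A$ and $B$ be associative unital rings, not necessarily commutative, and let ${}_B\Sigma_A$ be a $(B,A)$-bimodule such that ${}_B\Sigma$ is faithful and $\Sigma_A$ is finitely generated and projective. Let $S=\mathrm{End}(\Sigma_A)$, with the injective ring map $B\to S$, $b\mapsto(x\mapsto bx)$, by which $B$ is regarded as a subring of $S$, and let $\Sigma^*=\mathrm{Hom}(\Sigma_A,A_A)$, an $(A,B)$-bimodule by $(af)(x)=a\,f(x)$ and $(fb)(x)=f(bx)$. Let $\mathbf{Inv}_B(S)$ be the group of invertible elements of the monoid of all $B$-sub-bimodules $I\subseteq S$, where $IJ$ is the set of finite sums of products $xy$ with $x\in I$, $y\in J$, and the unit is $B$. The comatrix coring is the $A$-bimodule $\Sigma^*\otimes_B\Sigma$ with $$\Delta(f\otimes_B x)=\sum_i (f\otimes_B e_i)\otimes_A(e_i^*\otimes_B x),\qquad \varepsilon(f\otimes_B x)=f(x),$$ where $\{(e_i,e_i^*)\}_i\subseteq\Sigma\times\Sigma^*$ is any finite dual basis, that is, $x=\sum_i e_i\,e_i^*(x)$ for all $x\in\Sigma$; $\Delta$ does not depend on its choice. Let $\mathrm{Aut}_A(\Sigma^*\otimes_B\Sigma)$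 be its group of coring automorphisms under composition: the bijective $A$-bilinear maps $\phi$ with $\varepsilon\circ\phi=\varepsilon$ and $\Delta\circ\phi=(\phi\otimes_A\phi)\circ\Delta$. Assume that either (a) ${}_B\Sigma$ or $\Sigma^*_B$ is a faithfully flat module, or (b) ${}_B\Sigma_A$ is a separable bimodule, that is, the evaluation map $\Sigma\otimes_A{}^*\Sigma\to B$, $x\otimes_A f\mapsto f(x)$, where ${}^*\Sigma=\mathrm{Hom}({}_B\Sigma,{}_BB)$, is a split epimorphism of $B$-bimodules. Then there is an isomorphism of groups $$\Gamma:\mathbf{Inv}_B(S)\longrightarrow\mathrm{Aut}_A(\Sigma^*\otimes_B\Sigma)$$ such that, for every $I\in\mathbf{Inv}_B(S)$ and all $s_1,\dots,s_n\in S$ and $x_1,\dots,x_n\in I$ with $\sum_k s_kx_k=1$, $$\Gamma(I)(f\otimes_B u)=\sum_k f s_k\otimes_B x_k u\qquad(f\in\Sigma^*,\ u\in\Sigma),$$ where $fs_k=f\circ s_k$ and $x_ku=x_k(u)$. -/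

import Mathlib

open scoped TensorProduct
open MulOpposite (op unop)

universe u v w

namespace ComatrixCoring

/-! Rings are associative and unital, not necessarily commutative.  A right `A`-module is a module
over `Aᵐᵒᵖ`, with `op a • x` standing for `x a`; a `(B, A)`-bimodule `M` is an abelian group with
`[Module B M] [Module Aᵐᵒᵖ M] [SMulCommClass B Aᵐᵒᵖ M]`. -/

/-! ### The tensor product over a noncommutative ring -/

section Tensor

/-- The relations `(m b) ⊗ n = m ⊗ (b n)`. -/
def balancedRel (B M N : Type*) [Ring B] [AddCommGroup M] [Module Bᵐᵒᵖ M] [AddCommGroup N]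
    [Module B N] : AddSubgroup (M ⊗[ℤ] N) :=
  AddSubgroup.closure
    {t | ∃ (m : M) (b : B) (n : N), t = (op b • m) ⊗ₜ[ℤ] n - m ⊗ₜ[ℤ] (b • n)}

/-- The tensor product `M ⊗_B N` of a right `B`-module and a left `B`-module, an abelian group. -/
def TensorOver (B M N : Type*) [Ring B] [AddCommGroup M] [Module Bᵐᵒᵖ M] [AddCommGroup N]
    [Module B N] : Type _ :=
  (M ⊗[ℤ] N) ⧸ balancedRel B M N

variable {B M N P : Type*} [Ring B] [AddCommGroup M] [Module Bᵐᵒᵖ M] [AddCommGroup N] [Module B N]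
  [AddCommGroup P]

instance : AddCommGroup (TensorOver B M N) :=
  inferInstanceAs (AddCommGroup ((M ⊗[ℤ] N) ⧸ balancedRel B M N))

namespace TensorOver

variable (B) in
/-- The pure tensor `m ⊗_B n`. -/
def tmul (m : M) (n : N) : TensorOver B M N :=
  QuotientAddGroup.mk' (balancedRel B M N) (m ⊗ₜ[ℤ] n)

theorem add_tmul (m m' : M) (n : N) : tmul B (m + m') n = tmul B m n + tmul B m' n := by
  simp only [tmul, TensorProduct.add_tmul, map_add]
  rfl

theorem tmul_add (m : M) (n n' : N) : tmul B m (n + n') = tmul B m n + tmul B m n' := by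
  simp only [tmul, TensorProduct.tmul_add, map_add]
  rfl

theorem balanced (m : M) (b : B) (n : N) : tmul B (op b • m) n = tmul B m (b • n) := by
  have h : QuotientAddGroup.mk' (balancedRel B M N)
      ((op b • m) ⊗ₜ[ℤ] n - m ⊗ₜ[ℤ] (b • n)) = 0 :=
    (QuotientAddGroup.eq_zero_iff _).2 (AddSubgroup.subset_closure ⟨m, b, n, rfl⟩)
  rw [map_sub] at h
  exact sub_eq_zero.1 h

variable (B M N) in
/-- `tmul` as a biadditive map. -/
def tmulHom : M →+ N →+ TensorOver B M N :=
  AddMonoidHom.mk' (fun m => AddMonoidHom.mk' (fun n => tmul B m n) (tmul_add m))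
    (fun m m' => AddMonoidHom.ext (add_tmul m m'))

@[simp] theorem tmulHom_apply (m : M) (n : N) : tmulHom B M N m n = tmul B m n := rfl

theorem zero_tmul (n : N) : tmul B (0 : M) n = 0 := map_zero ((tmulHom B M N).flip n)

theorem tmul_zero (m : M) : tmul B m (0 : N) = 0 := map_zero (tmulHom B M N m)

theorem sum_tmul {ι : Type*} (s : Finset ι) (f : ι → M) (n : N) :
    tmul B (∑ i ∈ s, f i) n = ∑ i ∈ s, tmul B (f i) n := by
  change (tmulHom B M N).flip n (∑ i ∈ s, f i) = _
  rw [map_sum]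
  rfl

theorem tmul_sum {ι : Type*} (s : Finset ι) (m : M) (f : ι → N) :
    tmul B m (∑ i ∈ s, f i) = ∑ i ∈ s, tmul B m (f i) :=
  map_sum (tmulHom B M N m) f s

@[elab_as_elim]
theorem induction {p : TensorOver B M N → Prop} (z : TensorOver B M N)
    (tmul : ∀ m n, p (tmul B m n)) (add : ∀ x y, p x → p y → p (x + y)) : p z := by
  obtain ⟨t, rfl⟩ := QuotientAddGroup.mk'_surjective (balancedRel B M N) z
  induction t using TensorProduct.induction_on with
  | zero => simpa [TensorOver.tmul] using tmul 0 0
  | tmul m n => exact tmul m n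
  | add x y hx hy => rw [map_add]; exact add _ _ hx hy

/-- The universal property: a balanced biadditive map induces an additive map on `M ⊗_B N`. -/
def lift (f : M →+ N →+ P) (hf : ∀ (m : M) (b : B) (n : N), f (op b • m) n = f m (b • n)) :
    TensorOver B M N →+ P :=
  QuotientAddGroup.lift (balancedRel B M N)
    (TensorProduct.liftAddHom (R := ℤ) f (fun r m n => by simp))
    (by
      refine (AddSubgroup.closure_le _).2 ?_
      rintro _ ⟨m, b, n, rfl⟩
      change TensorProduct.liftAddHom (R := ℤ) f _ _ = 0
      simp [hf])

@[simp] theorem lift_tmul (f : M →+ N →+ P) (hf : ∀ (m : M) (b : B) (n : N), f (op b • m) n = f m (b • n))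
    (m : M) (n : N) : lift f hf (tmul B m n) = f m n := rfl

theorem hom_ext {f g : TensorOver B M N →+ P} (h : ∀ m n, f (tmul B m n) = g (tmul B m n)) :
    f = g :=
  AddMonoidHom.ext fun z => induction z h fun x y hx hy => by rw [map_add, map_add, hx, hy]

/-- The map `f ⊗_B g` induced by a right `B`-linear `f` and a left `B`-linear `g`. -/
def map {M' N' : Type*} [AddCommGroup M'] [Module Bᵐᵒᵖ M'] [AddCommGroup N'] [Module B N']
    (f : M →ₗ[Bᵐᵒᵖ] M') (g : N →ₗ[B] N') : TensorOver B M N →+ TensorOver B M' N' :=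
  lift
    (AddMonoidHom.mk' (fun m => (tmulHom B M' N' (f m)).comp g.toAddMonoidHom)
      (fun m m' => by ext n; simp only [map_add]; rfl))
    (fun m b n => by simp [balanced])

@[simp] theorem map_tmul {M' N' : Type*} [AddCommGroup M'] [Module Bᵐᵒᵖ M'] [AddCommGroup N']
    [Module B N'] (f : M →ₗ[Bᵐᵒᵖ] M') (g : N →ₗ[B] N') (m : M) (n : N) :
    map f g (tmul B m n) = tmul B (f m) (g n) := rfl

section LeftAction

variable {A : Type*} [Ring A] [Module A M] [SMulCommClass A Bᵐᵒᵖ M]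

instance : SMul A (TensorOver B M N) :=
  ⟨fun a => map (Module.toModuleEnd Bᵐᵒᵖ M a) LinearMap.id⟩

@[simp] theorem smul_tmul (a : A) (m : M) (n : N) : a • tmul B m n = tmul B (a • m) n := rfl

/-- The left action on the first factor of `M ⊗_B N`, for an `(A, B)`-bimodule `M`. -/
instance leftModule : Module A (TensorOver B M N) where
  smul_zero a := map_zero (map (Module.toModuleEnd Bᵐᵒᵖ M a) (LinearMap.id (R := B) (M := N)))
  smul_add a := map_add (map (Module.toModuleEnd Bᵐᵒᵖ M a) (LinearMap.id (R := B) (M := N)))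
  one_smul z := by
    change map (Module.toModuleEnd Bᵐᵒᵖ M (1 : A)) LinearMap.id z = z
    induction z using induction with
    | tmul m n => simp
    | add x y hx hy => rw [map_add, hx, hy]
  mul_smul a b z := by
    change map (Module.toModuleEnd Bᵐᵒᵖ M (a * b)) LinearMap.id z =
      map (Module.toModuleEnd Bᵐᵒᵖ M a) LinearMap.id
        (map (Module.toModuleEnd Bᵐᵒᵖ M b) LinearMap.id z)
    induction z using induction with
    | tmul m n => simp [mul_smul]
    | add x y hx hy => simp only [map_add, hx, hy]
  add_smul a b z := by
    change map (Module.toModuleEnd Bᵐᵒᵖ M (a + b)) LinearMap.id z =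
      map (Module.toModuleEnd Bᵐᵒᵖ M a) LinearMap.id z +
        map (Module.toModuleEnd Bᵐᵒᵖ M b) LinearMap.id z
    induction z using induction with
    | tmul m n => simp [add_smul, add_tmul]
    | add x y hx hy => rw [map_add, hx, hy, map_add, map_add]; abel
  zero_smul z := by
    change map (Module.toModuleEnd Bᵐᵒᵖ M (0 : A)) LinearMap.id z = 0
    induction z using induction with
    | tmul m n => simp [zero_tmul]
    | add x y hx hy => rw [map_add, hx, hy, add_zero]

end LeftAction

section RightAction

variable {C : Type*} [Ring C] [Module Cᵐᵒᵖ N] [SMulCommClass B Cᵐᵒᵖ N]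

instance rightSMul : SMul Cᵐᵒᵖ (TensorOver B M N) :=
  haveI := SMulCommClass.symm B Cᵐᵒᵖ N
  ⟨fun c => map LinearMap.id (Module.toModuleEnd B N c)⟩

@[simp] theorem op_smul_tmul (c : Cᵐᵒᵖ) (m : M) (n : N) :
    c • tmul B m n = tmul B m (c • n) := rfl

/-- The right action on the second factor of `M ⊗_B N`, for a `(B, C)`-bimodule `N`. -/
instance rightModule : Module Cᵐᵒᵖ (TensorOver B M N) :=
  haveI := SMulCommClass.symm B Cᵐᵒᵖ N
  { smul_zero := fun c => map_zero (map (LinearMap.id (R := Bᵐᵒᵖ) (M := M))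
      (Module.toModuleEnd B N c))
    smul_add := fun c => map_add (map (LinearMap.id (R := Bᵐᵒᵖ) (M := M))
      (Module.toModuleEnd B N c))
    one_smul := fun z => by
      change map LinearMap.id (Module.toModuleEnd B N (1 : Cᵐᵒᵖ)) z = z
      induction z using induction with
      | tmul m n => simp
      | add x y hx hy => rw [map_add, hx, hy]
    mul_smul := fun a b z => by
      change map LinearMap.id (Module.toModuleEnd B N (a * b)) z =
        map LinearMap.id (Module.toModuleEnd B N a)
          (map LinearMap.id (Module.toModuleEnd B N b) z)
      induction z using induction with
      | tmul m n => simp [mul_smul]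
      | add x y hx hy => simp only [map_add, hx, hy]
    add_smul := fun a b z => by
      change map LinearMap.id (Module.toModuleEnd B N (a + b)) z =
        map LinearMap.id (Module.toModuleEnd B N a) z +
          map LinearMap.id (Module.toModuleEnd B N b) z
      induction z using induction with
      | tmul m n => simp [add_smul, tmul_add]
      | add x y hx hy => rw [map_add, hx, hy, map_add, map_add]; abel
    zero_smul := fun z => by
      change map LinearMap.id (Module.toModuleEnd B N (0 : Cᵐᵒᵖ)) z = 0
      induction z using induction with
      | tmul m n => simp [tmul_zero]
      | add x y hx hy => rw [map_add, hx, hy, add_zero] }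

end RightAction

instance {A C : Type*} [Ring A] [Module A M] [SMulCommClass A Bᵐᵒᵖ M] [Ring C] [Module Cᵐᵒᵖ N]
    [SMulCommClass B Cᵐᵒᵖ N] : SMulCommClass A Cᵐᵒᵖ (TensorOver B M N) where
  smul_comm a c z := by
    induction z using induction with
    | tmul m n => simp
    | add x y hx hy => simp only [smul_add, hx, hy]

variable (B N) in
/-- The canonical map `B ⊗_B N → N`, `b ⊗ n ↦ b n`. -/
def lid : TensorOver B B N →+ N :=
  lift (Module.toAddMonoidEnd B N).toAddMonoidHom (fun b c n => mul_smul b c n)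

@[simp] theorem lid_tmul (b : B) (n : N) : lid B N (tmul B b n) = b • n := rfl

variable (B M) in
/-- The canonical map `M ⊗_B B → M`, `m ⊗ b ↦ m b`. -/
def rid : TensorOver B M B →+ M :=
  lift (AddMonoidHom.mk' (fun m => AddMonoidHom.mk' (fun b : B => op b • m)
      (fun b c => by rw [MulOpposite.op_add, add_smul]))
      (fun m m' => by ext b; simp))
    (fun m b c => by simp [mul_smul])

@[simp] theorem rid_tmul (m : M) (b : B) : rid B M (tmul B m b) = op b • m := rfl

/-- Auxiliary to `assoc`: the map `m ⊗ n ↦ (q ↦ m ⊗ (n ⊗ q))`. -/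
def assocAux (C Q : Type*) [Ring C] [Module Cᵐᵒᵖ N] [SMulCommClass B Cᵐᵒᵖ N] [AddCommGroup Q]
    [Module C Q] : TensorOver B M N →+ Q →+ TensorOver B M (TensorOver C N Q) :=
  lift
    (AddMonoidHom.mk' (fun m => AddMonoidHom.mk'
        (fun n => (tmulHom B M (TensorOver C N Q) m).comp (tmulHom C N Q n))
        (fun n n' => by ext q; change tmul B m (tmul C (n + n') q) = _; rw [add_tmul, tmul_add]; rfl))
      (fun m m' => by ext n q; exact add_tmul m m' (tmul C n q)))
    (fun m b n => by ext q; exact balanced m b (tmul C n q))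

/-- The canonical map `(M ⊗_B N) ⊗_C Q → M ⊗_B (N ⊗_C Q)`. -/
def assoc {C Q : Type*} [Ring C] [Module Cᵐᵒᵖ N] [SMulCommClass B Cᵐᵒᵖ N] [AddCommGroup Q]
    [Module C Q] : TensorOver C (TensorOver B M N) Q →+ TensorOver B M (TensorOver C N Q) :=
  lift (assocAux C Q)
    (fun z c q => by
      induction z using induction with
      | tmul m n => exact congrArg (tmul B m) (balanced n c q)
      | add x y hx hy =>
        rw [smul_add, map_add, AddMonoidHom.add_apply, hx, hy, map_add, AddMonoidHom.add_apply])

@[simp] theorem assoc_tmul {C Q : Type*} [Ring C] [Module Cᵐᵒᵖ N] [SMulCommClass B Cᵐᵒᵖ N]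
    [AddCommGroup Q] [Module C Q] (m : M) (n : N) (q : Q) :
    assoc (tmul C (tmul B m n) q) = tmul B m (tmul C n q) := rfl

end TensorOver

end Tensor

/-! ### Homomorphisms of bimodules -/

/-- An `(R, S)`-bilinear map between `(R, S)`-bimodules. -/
structure BimodHom (R S M N : Type*) [Ring R] [Ring S] [AddCommGroup M] [Module R M]
    [Module Sᵐᵒᵖ M] [AddCommGroup N] [Module R N] [Module Sᵐᵒᵖ N] extends M →+ N where
  map_smul' : ∀ (r : R) (x : M), toFun (r • x) = r • toFun x
  map_op_smul' : ∀ (s : S) (x : M), toFun (op s • x) = op s • toFun x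

namespace BimodHom

variable {R S M N P : Type*} [Ring R] [Ring S] [AddCommGroup M] [Module R M]
    [Module Sᵐᵒᵖ M] [AddCommGroup N] [Module R N] [Module Sᵐᵒᵖ N]
    [AddCommGroup P] [Module R P] [Module Sᵐᵒᵖ P]

instance : FunLike (BimodHom R S M N) M N where
  coe f := f.toFun
  coe_injective f g h := by
    cases f; cases g; congr; exact DFunLike.coe_injective h

instance : AddMonoidHomClass (BimodHom R S M N) M N where
  map_add f := f.map_add'
  map_zero f := f.map_zero'

@[ext] theorem ext {f g : BimodHom R S M N} (h : ∀ x, f x = g x) : f = g := DFunLike.ext f g h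

/-- The underlying left linear map. -/
def left (f : BimodHom R S M N) : M →ₗ[R] N :=
  { f.toAddMonoidHom with map_smul' := f.map_smul' }

/-- The underlying right linear map. -/
def right (f : BimodHom R S M N) : M →ₗ[Sᵐᵒᵖ] N :=
  { f.toAddMonoidHom with map_smul' := fun s => f.map_op_smul' (unop s) }

@[simp] theorem left_apply (f : BimodHom R S M N) (x : M) : f.left x = f x := rfl

@[simp] theorem right_apply (f : BimodHom R S M N) (x : M) : f.right x = f x := rfl

variable (R S M) in
/-- The identity. -/
def id : BimodHom R S M M :=
  { AddMonoidHom.id M with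
    map_smul' := fun _ _ => rfl
    map_op_smul' := fun _ _ => rfl }

/-- Composition. -/
def comp (g : BimodHom R S N P) (f : BimodHom R S M N) : BimodHom R S M P :=
  { g.toAddMonoidHom.comp f.toAddMonoidHom with
    map_smul' := fun r x => (congrArg g (f.map_smul' r x)).trans (g.map_smul' r _)
    map_op_smul' := fun s x => (congrArg g (f.map_op_smul' s x)).trans (g.map_op_smul' s _) }

@[simp] theorem id_apply (x : M) : BimodHom.id R S M x = x := rfl

@[simp] theorem comp_apply (g : BimodHom R S N P) (f : BimodHom R S M N) (x : M) :
    g.comp f x = g (f x) := rfl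

end BimodHom

/-! ### Corings and their automorphisms -/

/-- An `A`-coring structure on an `A`-bimodule `C`. -/
class Coring (A C : Type*) [Ring A] [AddCommGroup C] [Module A C] [Module Aᵐᵒᵖ C]
    [SMulCommClass A Aᵐᵒᵖ C] where
  comul : BimodHom A A C (TensorOver A C C)
  counit : BimodHom A A C A
  coassoc : ∀ c : C,
    TensorOver.assoc (TensorOver.map comul.right LinearMap.id (comul c)) =
      TensorOver.map LinearMap.id comul.left (comul c)
  counit_left : ∀ c : C,
    TensorOver.lid A C (TensorOver.map counit.right LinearMap.id (comul c)) = c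
  counit_right : ∀ c : C,
    TensorOver.rid A C (TensorOver.map LinearMap.id counit.left (comul c)) = c

/-- An endomorphism of an `A`-coring `C`. -/
structure CoringEnd (A C : Type*) [Ring A] [AddCommGroup C] [Module A C] [Module Aᵐᵒᵖ C]
    [SMulCommClass A Aᵐᵒᵖ C] [Coring A C] extends BimodHom A A C C where
  counit_comp : ∀ c : C, Coring.counit (A := A) (toBimodHom c) = Coring.counit (A := A) c
  comul_comp : ∀ c : C, Coring.comul (A := A) (toBimodHom c) =
    TensorOver.map toBimodHom.right toBimodHom.left (Coring.comul (A := A) c)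

namespace CoringEnd

variable {A C : Type*} [Ring A] [AddCommGroup C] [Module A C] [Module Aᵐᵒᵖ C]
    [SMulCommClass A Aᵐᵒᵖ C] [Coring A C]

instance : FunLike (CoringEnd A C) C C where
  coe f := f.toBimodHom
  coe_injective f g h := by
    cases f; cases g; congr; exact DFunLike.coe_injective h

@[simp] theorem toBimodHom_apply (f : CoringEnd A C) (c : C) : f.toBimodHom c = f c := rfl

@[ext] theorem ext {f g : CoringEnd A C} (h : ∀ x, f x = g x) : f = g := DFunLike.ext f g h

/-- The monoid of coring endomorphisms under composition. -/
instance : Monoid (CoringEnd A C) where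
  one :=
    { BimodHom.id A A C with
      counit_comp := fun _ => rfl
      comul_comp := fun c => by
        change Coring.comul (A := A) c = TensorOver.map LinearMap.id LinearMap.id _
        generalize Coring.comul (A := A) c = z
        induction z using TensorOver.induction with
        | tmul m n => rfl
        | add x y hx hy => rw [map_add, ← hx, ← hy] }
  mul g f :=
    { g.toBimodHom.comp f.toBimodHom with
      counit_comp := fun c => (g.counit_comp (f c)).trans (f.counit_comp c)
      comul_comp := fun c => by
        change Coring.comul (A := A) (g.toBimodHom (f.toBimodHom c)) =
          TensorOver.map (g.toBimodHom.comp f.toBimodHom).right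
            (g.toBimodHom.comp f.toBimodHom).left _
        rw [g.comul_comp, f.comul_comp]
        generalize Coring.comul (A := A) c = z
        induction z using TensorOver.induction with
        | tmul m n => rfl
        | add x y hx hy => simp only [map_add, hx, hy] }
  mul_assoc _ _ _ := rfl
  one_mul _ := rfl
  mul_one _ := rfl

@[simp] theorem one_apply (c : C) : (1 : CoringEnd A C) c = c := rfl

@[simp] theorem mul_apply (g f : CoringEnd A C) (c : C) : (g * f) c = g (f c) := rfl

end CoringEnd

/-- The group of automorphisms of an `A`-coring `C`: the units of the monoid of coring
endomorphisms. -/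
abbrev CoringAut (A C : Type*) [Ring A] [AddCommGroup C] [Module A C] [Module Aᵐᵒᵖ C]
    [SMulCommClass A Aᵐᵒᵖ C] [Coring A C] : Type _ :=
  (CoringEnd A C)ˣ

/-! ### The duals of a bimodule -/

section Duals

variable (B A M : Type*) [Ring B] [Ring A] [AddCommGroup M] [Module B M] [Module Aᵐᵒᵖ M]

/-- The right dual `M^* = Hom(M_A, A_A)`. -/
def RightDual : Type _ := M →ₗ[Aᵐᵒᵖ] A

/-- The left dual `^*M = Hom(_B M, _B B)`. -/
def LeftDual : Type _ := M →ₗ[B] B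

instance : AddCommGroup (RightDual A M) := inferInstanceAs (AddCommGroup (M →ₗ[Aᵐᵒᵖ] A))

instance : AddCommGroup (LeftDual B M) := inferInstanceAs (AddCommGroup (M →ₗ[B] B))

instance : FunLike (RightDual A M) M A := inferInstanceAs (FunLike (M →ₗ[Aᵐᵒᵖ] A) M A)

instance : FunLike (LeftDual B M) M B := inferInstanceAs (FunLike (M →ₗ[B] B) M B)

instance : LinearMapClass (RightDual A M) Aᵐᵒᵖ M A :=
  inferInstanceAs (LinearMapClass (M →ₗ[Aᵐᵒᵖ] A) Aᵐᵒᵖ M A)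

instance : LinearMapClass (LeftDual B M) B M B :=
  inferInstanceAs (LinearMapClass (M →ₗ[B] B) B M B)

variable {B A M}

@[ext] theorem RightDual.ext {f g : RightDual A M} (h : ∀ x, f x = g x) : f = g :=
  DFunLike.ext f g h

@[ext] theorem LeftDual.ext {f g : LeftDual B M} (h : ∀ x, f x = g x) : f = g :=
  DFunLike.ext f g h

@[simp] theorem RightDual.add_apply (f g : RightDual A M) (x : M) : (f + g) x = f x + g x := rfl

@[simp] theorem RightDual.zero_apply (x : M) : (0 : RightDual A M) x = 0 := rfl

@[simp] theorem LeftDual.add_apply (f g : LeftDual B M) (x : M) : (f + g) x = f x + g x := rfl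

@[simp] theorem LeftDual.zero_apply (x : M) : (0 : LeftDual B M) x = 0 := rfl

/-- The left `A`-action `(a f)(x) = a f(x)` on the right dual. -/
instance : Module A (RightDual A M) := inferInstanceAs (Module A (M →ₗ[Aᵐᵒᵖ] A))

@[simp] theorem RightDual.smul_apply (a : A) (f : RightDual A M) (x : M) :
    (a • f) x = a * f x := rfl

/-- The composite `f s` of a functional `f` and an endomorphism `s` of `M_A`. -/
def RightDual.comp (f : RightDual A M) (s : Module.End Aᵐᵒᵖ M) : RightDual A M :=
  LinearMap.comp (M₂ := M) (M₃ := A) f s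

@[simp] theorem RightDual.comp_apply (f : RightDual A M) (s : Module.End Aᵐᵒᵖ M) (x : M) :
    f.comp s x = f (s x) := rfl

/-- The right `B`-action `(b' f)(x) = f(x b)` on the left dual. -/
instance : Module Bᵐᵒᵖ (LeftDual B M) := inferInstanceAs (Module Bᵐᵒᵖ (M →ₗ[B] B))

@[simp] theorem LeftDual.op_smul_apply (b : B) (f : LeftDual B M) (x : M) :
    (op b • f) x = f x * b := rfl

variable [SMulCommClass B Aᵐᵒᵖ M]

/-- The right `B`-action `(f b)(x) = f(b x)` on the right dual. -/
instance : Module Bᵐᵒᵖ (RightDual A M) where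
  smul b f := f.comp (Module.toModuleEnd Aᵐᵒᵖ M (unop b))
  one_smul f := RightDual.ext fun x => congrArg f (one_smul B x)
  mul_smul b c f := RightDual.ext fun x => congrArg f (mul_smul (unop c) (unop b) x)
  smul_zero _ := rfl
  smul_add _ _ _ := rfl
  add_smul b c f := RightDual.ext fun x =>
    (congrArg f (add_smul (unop b) (unop c) x)).trans (map_add f _ _)
  zero_smul f := RightDual.ext fun x => (congrArg f (zero_smul B x)).trans (map_zero f)

@[simp] theorem RightDual.op_smul_apply (b : B) (f : RightDual A M) (x : M) :
    (op b • f) x = f (b • x) := rfl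

instance : SMulCommClass A Bᵐᵒᵖ (RightDual A M) where
  smul_comm _ _ _ := rfl

/-- The left `A`-action `(a f)(x) = f(x a)` on the left dual. -/
instance : Module A (LeftDual B M) :=
  haveI := SMulCommClass.symm B Aᵐᵒᵖ M
  { smul := fun a f =>
      (LinearMap.comp (M₂ := M) (M₃ := B) f (Module.toModuleEnd B M (op a)) : M →ₗ[B] B)
    one_smul := fun f => LeftDual.ext fun x => congrArg f (one_smul Aᵐᵒᵖ x)
    mul_smul := fun a c f => LeftDual.ext fun x => congrArg f (mul_smul (op c) (op a) x)
    smul_zero := fun _ => rfl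
    smul_add := fun _ _ _ => rfl
    add_smul := fun a c f => LeftDual.ext fun x =>
      (congrArg f (add_smul (op a) (op c) x)).trans (map_add f _ _)
    zero_smul := fun f => LeftDual.ext fun x =>
      (congrArg f (zero_smul Aᵐᵒᵖ x)).trans (map_zero f) }

@[simp] theorem LeftDual.smul_apply (a : A) (f : LeftDual B M) (x : M) :
    (a • f) x = f (op a • x) := rfl

instance : SMulCommClass A Bᵐᵒᵖ (LeftDual B M) where
  smul_comm _ _ _ := rfl

end Duals

/-! ### The comatrix coring -/

section Comatrix

/-- A finite dual basis of a right `A`-module: `x = ∑ᵢ eᵢ eᵢ^*(x)` for all `x`. -/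
structure DualBasis (A M : Type*) [Ring A] [AddCommGroup M] [Module Aᵐᵒᵖ M] where
  size : ℕ
  vec : Fin size → M
  covec : Fin size → RightDual A M
  sum_eq : ∀ x : M, ∑ i, op (covec i x) • vec i = x

/-- A finitely generated projective right module has a finite dual basis. -/
theorem nonempty_dualBasis (A M : Type*) [Ring A] [AddCommGroup M] [Module Aᵐᵒᵖ M]
    [Module.Finite Aᵐᵒᵖ M] [Module.Projective Aᵐᵒᵖ M] : Nonempty (DualBasis A M) := by
  obtain ⟨n, f, g, -, -, hfg⟩ := Module.Finite.exists_comp_eq_id_of_projective Aᵐᵒᵖ M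
  refine ⟨⟨n, fun i => f (Pi.single i 1), fun i =>
    (show M →ₗ[Aᵐᵒᵖ] A from
      { toFun := fun x => unop (g x i)
        map_add' := fun x y => by simp
        map_smul' := fun a x => by simp [MulOpposite.smul_eq_mul_unop] }), fun x => ?_⟩⟩
  have h : f (g x) = x := LinearMap.congr_fun hfg x
  conv_rhs => rw [← h, ← Finset.univ_sum_single (g x), map_sum]
  refine Finset.sum_congr rfl fun i _ => ?_
  change g x i • f (Pi.single i 1) = _
  rw [← map_smul, ← Pi.single_smul]
  simp

variable (B A M : Type*) [Ring B] [Ring A] [AddCommGroup M] [Module B M] [Module Aᵐᵒᵖ M]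
  [SMulCommClass B Aᵐᵒᵖ M]

/-- The `A`-bimodule `M^* ⊗_B M`. -/
abbrev Comatrix : Type _ := TensorOver B (RightDual A M) M

variable {B A M}

theorem DualBasis.sum_smul_covec (D : DualBasis A M) (f : RightDual A M) :
    ∑ i, f (D.vec i) • D.covec i = f := by
  ext x
  have h : (∑ i, f (D.vec i) • D.covec i) x = ∑ i, f (D.vec i) * D.covec i x :=
    map_sum (AddMonoidHom.mk' (fun p : RightDual A M => p x) (fun _ _ => rfl)) _ _
  rw [h]
  conv_rhs => rw [← D.sum_eq x, map_sum]
  exact Finset.sum_congr rfl fun i _ => by rw [map_smul, op_smul_eq_mul]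

variable (B) in
/-- The biadditive map `(f, x) ↦ ∑ᵢ (f ⊗ eᵢ) ⊗ (eᵢ^* ⊗ x)`. -/
def comatrixComulAux (D : DualBasis A M) :
    RightDual A M →+ M →+ TensorOver A (Comatrix B A M) (Comatrix B A M) :=
  AddMonoidHom.mk' (fun f => AddMonoidHom.mk'
      (fun x => ∑ i, TensorOver.tmul A (TensorOver.tmul B f (D.vec i))
        (TensorOver.tmul B (D.covec i) x))
      (fun x y => by simp only [TensorOver.tmul_add, Finset.sum_add_distrib]))
    (fun f g => by
      ext x
      simp [TensorOver.add_tmul, Finset.sum_add_distrib])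

theorem comatrixComulAux_balanced (D : DualBasis A M) (f : RightDual A M) (b : B) (x : M) :
    comatrixComulAux B D (op b • f) x = comatrixComulAux B D f (b • x) := by
  change ∑ i, TensorOver.tmul A (TensorOver.tmul B (op b • f) (D.vec i))
        (TensorOver.tmul B (D.covec i) x) =
      ∑ j, TensorOver.tmul A (TensorOver.tmul B f (D.vec j))
        (TensorOver.tmul B (D.covec j) (b • x))
  have h1 : ∀ i, TensorOver.tmul A (TensorOver.tmul B (op b • f) (D.vec i))
        (TensorOver.tmul B (D.covec i) x) =
      ∑ j, TensorOver.tmul A (TensorOver.tmul B f (D.vec j))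
        (TensorOver.tmul B (D.covec j (b • D.vec i) • D.covec i) x) := by
    intro i
    rw [TensorOver.balanced, ← D.sum_eq (b • D.vec i), TensorOver.tmul_sum, TensorOver.sum_tmul]
    refine Finset.sum_congr rfl fun j _ => ?_
    rw [← TensorOver.op_smul_tmul, TensorOver.balanced, TensorOver.smul_tmul, D.sum_eq]
  have h2 : ∀ j, TensorOver.tmul A (TensorOver.tmul B f (D.vec j))
        (TensorOver.tmul B (D.covec j) (b • x)) =
      ∑ i, TensorOver.tmul A (TensorOver.tmul B f (D.vec j))
        (TensorOver.tmul B (D.covec j (b • D.vec i) • D.covec i) x) := by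
    intro j
    rw [← TensorOver.balanced, ← D.sum_smul_covec (op b • D.covec j), TensorOver.sum_tmul,
      TensorOver.tmul_sum]
    rfl
  rw [Finset.sum_congr rfl fun i _ => h1 i, Finset.sum_congr rfl fun j _ => h2 j,
    Finset.sum_comm]

variable (B) in
/-- The comultiplication `f ⊗ x ↦ ∑ᵢ (f ⊗ eᵢ) ⊗ (eᵢ^* ⊗ x)` of `M^* ⊗_B M`. -/
def comatrixComul (D : DualBasis A M) :
    BimodHom A A (Comatrix B A M) (TensorOver A (Comatrix B A M) (Comatrix B A M)) :=
  { TensorOver.lift (comatrixComulAux B D) (comatrixComulAux_balanced D) with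
    map_smul' := fun a z => by
      change TensorOver.lift (comatrixComulAux B D) (comatrixComulAux_balanced D) (a • z) =
        a • TensorOver.lift (comatrixComulAux B D) (comatrixComulAux_balanced D) z
      induction z using TensorOver.induction with
      | tmul f x => simp [comatrixComulAux, Finset.smul_sum]
      | add y z hy hz => simp only [smul_add, map_add, hy, hz]
    map_op_smul' := fun a z => by
      change TensorOver.lift (comatrixComulAux B D) (comatrixComulAux_balanced D) (op a • z) =
        op a • TensorOver.lift (comatrixComulAux B D) (comatrixComulAux_balanced D) z
      induction z using TensorOver.induction with
      | tmul f x => simp [comatrixComulAux, Finset.smul_sum]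
      | add y z hy hz => simp only [smul_add, map_add, hy, hz] }

theorem comatrixComul_tmul (D : DualBasis A M) (f : RightDual A M) (x : M) :
    comatrixComul B D (TensorOver.tmul B f x) =
      ∑ i, TensorOver.tmul A (TensorOver.tmul B f (D.vec i))
        (TensorOver.tmul B (D.covec i) x) := rfl

/-- The comultiplication does not depend on the dual basis. -/
theorem comatrixComul_eq (D E : DualBasis A M) : comatrixComul B D = comatrixComul B E := by
  ext z
  induction z using TensorOver.induction with
  | tmul f x =>
    rw [comatrixComul_tmul, comatrixComul_tmul]
    have h1 : ∀ i, TensorOver.tmul A (TensorOver.tmul B f (D.vec i))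
          (TensorOver.tmul B (D.covec i) x) =
        ∑ j, TensorOver.tmul A (TensorOver.tmul B f (E.vec j))
          (TensorOver.tmul B (E.covec j (D.vec i) • D.covec i) x) := by
      intro i
      conv_lhs => rw [← E.sum_eq (D.vec i), TensorOver.tmul_sum, TensorOver.sum_tmul]
      refine Finset.sum_congr rfl fun j _ => ?_
      rw [← TensorOver.op_smul_tmul, TensorOver.balanced, TensorOver.smul_tmul]
    rw [Finset.sum_congr rfl fun i _ => h1 i, Finset.sum_comm]
    refine Finset.sum_congr rfl fun j _ => ?_
    rw [← TensorOver.tmul_sum, ← TensorOver.sum_tmul, D.sum_smul_covec]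
  | add y z hy hz => simp only [map_add, hy, hz]

variable (B A M) in
/-- The counit `f ⊗ x ↦ f(x)` of `M^* ⊗_B M`. -/
def comatrixCounit : BimodHom A A (Comatrix B A M) A :=
  let ev : Comatrix B A M →+ A := TensorOver.lift
    (AddMonoidHom.mk' (fun f : RightDual A M => AddMonoidHom.mk' (fun x : M => f x) (map_add f))
      (fun _ _ => rfl)) (fun _ _ _ => rfl)
  { ev with
    map_smul' := fun a z => by
      change ev (a • z) = a • ev z
      induction z using TensorOver.induction with
      | tmul f x => rfl
      | add y z hy hz => simp only [smul_add, map_add, hy, hz]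
    map_op_smul' := fun a z => by
      change ev (op a • z) = op a • ev z
      induction z using TensorOver.induction with
      | tmul f x => exact map_smul f (op a) x
      | add y z hy hz => simp only [smul_add, map_add, hy, hz] }

@[simp] theorem comatrixCounit_tmul (f : RightDual A M) (x : M) :
    comatrixCounit B A M (TensorOver.tmul B f x) = f x := rfl

/-- The comatrix coring `M^* ⊗_B M` of a `(B, A)`-bimodule `M` which is finitely generated and
projective as a right `A`-module. -/
noncomputable instance comatrixCoring [Module.Finite Aᵐᵒᵖ M] [Module.Projective Aᵐᵒᵖ M] :
    Coring A (Comatrix B A M) where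
  comul := comatrixComul B (nonempty_dualBasis A M).some
  counit := comatrixCounit B A M
  coassoc c := by
    generalize (nonempty_dualBasis A M).some = D
    induction c using TensorOver.induction with
    | tmul f x =>
      simp only [comatrixComul_tmul, map_sum, TensorOver.map_tmul, BimodHom.right_apply,
        BimodHom.left_apply, LinearMap.id_apply, TensorOver.sum_tmul, TensorOver.tmul_sum,
        TensorOver.assoc_tmul]
      exact Finset.sum_comm
    | add y z hy hz => simp only [map_add, hy, hz]
  counit_left c := by
    generalize (nonempty_dualBasis A M).some = D
    induction c using TensorOver.induction with
    | tmul f x =>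
      simp only [comatrixComul_tmul, map_sum, TensorOver.map_tmul, BimodHom.right_apply,
        LinearMap.id_apply, comatrixCounit_tmul, TensorOver.lid_tmul, TensorOver.smul_tmul]
      rw [← TensorOver.sum_tmul, D.sum_smul_covec]
    | add y z hy hz => simp only [map_add, hy, hz]
  counit_right c := by
    generalize (nonempty_dualBasis A M).some = D
    induction c using TensorOver.induction with
    | tmul f x =>
      simp only [comatrixComul_tmul, map_sum, TensorOver.map_tmul, BimodHom.left_apply,
        LinearMap.id_apply, comatrixCounit_tmul, TensorOver.rid_tmul, TensorOver.op_smul_tmul]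
      rw [← TensorOver.tmul_sum, D.sum_eq]
    | add y z hy hz => simp only [map_add, hy, hz]

end Comatrix

/-! ### Invertible sub-bimodules of a ring extension -/

/-- A `B`-sub-bimodule of `S`, for a ring extension `ι : B → S`. -/
structure SubBimodule {B S : Type*} [Ring B] [Ring S] (ι : B →+* S) extends AddSubgroup S where
  left_mem' : ∀ (b : B) {x : S}, x ∈ carrier → ι b * x ∈ carrier
  right_mem' : ∀ (b : B) {x : S}, x ∈ carrier → x * ι b ∈ carrier

namespace SubBimodule

variable {B S : Type*} [Ring B] [Ring S] {ι : B →+* S}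

instance : SetLike (SubBimodule ι) S where
  coe I := I.carrier
  coe_injective I J h := by
    cases I; cases J; congr; exact SetLike.coe_injective h

instance : AddSubgroupClass (SubBimodule ι) S where
  add_mem {I} := I.add_mem'
  zero_mem I := I.zero_mem'
  neg_mem {I} := I.neg_mem'

@[ext] theorem ext {I J : SubBimodule ι} (h : ∀ x, x ∈ I ↔ x ∈ J) : I = J := SetLike.ext h

theorem left_mem (I : SubBimodule ι) (b : B) {x : S} (hx : x ∈ I) : ι b * x ∈ I :=
  I.left_mem' b hx

theorem right_mem (I : SubBimodule ι) (b : B) {x : S} (hx : x ∈ I) : x * ι b ∈ I :=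
  I.right_mem' b hx

/-- The unit is the image of `B` in `S`. -/
instance : One (SubBimodule ι) where
  one :=
    { ι.range.toAddSubgroup with
      left_mem' := fun b _ hx => ι.range.mul_mem ⟨b, rfl⟩ hx
      right_mem' := fun b _ hx => ι.range.mul_mem hx ⟨b, rfl⟩ }

theorem mem_one {x : S} : x ∈ (1 : SubBimodule ι) ↔ ∃ b, ι b = x := Iff.rfl

/-- The product `I J` is the additive subgroup generated by all products `x y` with `x ∈ I` and
`y ∈ J`, that is, the set of finite sums of such products. -/
instance : Mul (SubBimodule ι) where
  mul I J :=
    { AddSubgroup.closure {z | ∃ x ∈ I, ∃ y ∈ J, z = x * y} with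
      left_mem' := fun b z hz => by
        change ι b * z ∈ AddSubgroup.closure _
        change z ∈ AddSubgroup.closure _ at hz
        induction hz using AddSubgroup.closure_induction with
        | mem z h =>
          obtain ⟨x, hx, y, hy, rfl⟩ := h
          exact AddSubgroup.subset_closure
            ⟨ι b * x, I.left_mem b hx, y, hy, (mul_assoc _ _ _).symm⟩
        | zero => rw [mul_zero]; exact zero_mem _
        | add _ _ _ _ h h' => rw [mul_add]; exact add_mem h h'
        | neg _ _ h => rw [mul_neg]; exact neg_mem h
      right_mem' := fun b z hz => by
        change z * ι b ∈ AddSubgroup.closure _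
        change z ∈ AddSubgroup.closure _ at hz
        induction hz using AddSubgroup.closure_induction with
        | mem z h =>
          obtain ⟨x, hx, y, hy, rfl⟩ := h
          exact AddSubgroup.subset_closure
            ⟨x, hx, y * ι b, J.right_mem b hy, mul_assoc _ _ _⟩
        | zero => rw [zero_mul]; exact zero_mem _
        | add _ _ _ _ h h' => rw [add_mul]; exact add_mem h h'
        | neg _ _ h => rw [neg_mul]; exact neg_mem h }

theorem mul_mem_mul {I J : SubBimodule ι} {x y : S} (hx : x ∈ I) (hy : y ∈ J) : x * y ∈ I * J :=
  AddSubgroup.subset_closure ⟨x, hx, y, hy, rfl⟩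

@[elab_as_elim]
theorem mul_induction {I J : SubBimodule ι} {p : S → Prop} {z : S} (hz : z ∈ I * J)
    (mul : ∀ x ∈ I, ∀ y ∈ J, p (x * y)) (add : ∀ x y, p x → p y → p (x + y)) : p z := by
  change z ∈ AddSubgroup.closure _ at hz
  have key : ∀ z ∈ AddSubgroup.closure {z | ∃ x ∈ I, ∃ y ∈ J, z = x * y}, p z ∧ p (-z) := by
    intro z hz
    induction hz using AddSubgroup.closure_induction with
    | mem z h =>
      obtain ⟨x, hx, y, hy, rfl⟩ := h
      exact ⟨mul x hx y hy, by rw [← neg_mul]; exact mul _ (neg_mem hx) _ hy⟩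
    | zero =>
      have h : p 0 := by simpa using mul 0 (zero_mem I) 0 (zero_mem J)
      exact ⟨h, by rwa [neg_zero]⟩
    | add _ _ _ _ h h' => exact ⟨add _ _ h.1 h'.1, by rw [neg_add]; exact add _ _ h.2 h'.2⟩
    | neg _ _ h => exact ⟨h.2, by rw [neg_neg]; exact h.1⟩
  exact (key z hz).1

/-- The monoid of all `B`-sub-bimodules of `S`. -/
instance : Monoid (SubBimodule ι) where
  mul_assoc I J K := by
    ext z
    constructor
    · intro hz
      refine mul_induction hz (fun x hx y hy => ?_) fun _ _ h h' => add_mem h h'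
      refine mul_induction hx (fun a ha b hb => ?_) fun _ _ h h' => ?_
      · rw [mul_assoc]; exact mul_mem_mul ha (mul_mem_mul hb hy)
      · rw [add_mul]; exact add_mem h h'
    · intro hz
      refine mul_induction hz (fun x hx y hy => ?_) fun _ _ h h' => add_mem h h'
      refine mul_induction hy (fun a ha b hb => ?_) fun _ _ h h' => ?_
      · rw [← mul_assoc]; exact mul_mem_mul (mul_mem_mul hx ha) hb
      · rw [mul_add]; exact add_mem h h'
  one_mul I := by
    ext z
    constructor
    · intro hz
      refine mul_induction hz (fun x hx y hy => ?_) fun _ _ h h' => add_mem h h'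
      obtain ⟨b, rfl⟩ := hx
      exact I.left_mem b hy
    · intro hz
      simpa using mul_mem_mul (mem_one.2 ⟨1, map_one ι⟩) hz
  mul_one I := by
    ext z
    constructor
    · intro hz
      refine mul_induction hz (fun x hx y hy => ?_) fun _ _ h h' => add_mem h h'
      obtain ⟨b, rfl⟩ := hy
      exact I.right_mem b hx
    · intro hz
      simpa using mul_mem_mul hz (mem_one.2 ⟨1, map_one ι⟩)

end SubBimodule

/-- The group of invertible `B`-sub-bimodules of `S`, for a ring extension `ι : B → S`. -/
abbrev InvSubBimodule {B S : Type*} [Ring B] [Ring S] (ι : B →+* S) : Type _ := (SubBimodule ι)ˣ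

/-- The ring extension `B → End(M_A)`, `b ↦ (x ↦ b x)`, of a `(B, A)`-bimodule `M`. -/
abbrev endExtension (B A M : Type*) [Ring B] [Ring A] [AddCommGroup M] [Module B M]
    [Module Aᵐᵒᵖ M] [SMulCommClass B Aᵐᵒᵖ M] : B →+* Module.End Aᵐᵒᵖ M :=
  Module.toModuleEnd Aᵐᵒᵖ M

/-! ### Faithfully flat modules and separable bimodules -/

/-- The left `B`-module `M` is faithfully flat: `- ⊗_B M` preserves injections, and kills no
nonzero right `B`-module. -/
structure LeftFaithfullyFlat (B : Type v) (M : Type w) [Ring B] [AddCommGroup M] [Module B M] :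
    Prop where
  flat : ∀ (N N' : Type (max v w)) [AddCommGroup N] [AddCommGroup N'] [Module Bᵐᵒᵖ N]
    [Module Bᵐᵒᵖ N'] (f : N →ₗ[Bᵐᵒᵖ] N'), Function.Injective f →
      Function.Injective (TensorOver.map f (LinearMap.id : M →ₗ[B] M))
  faithful : ∀ (N : Type (max v w)) [AddCommGroup N] [Module Bᵐᵒᵖ N],
    Subsingleton (TensorOver B N M) → Subsingleton N

/-- The right `B`-module `M` is faithfully flat: `M ⊗_B -` preserves injections, and kills no
nonzero left `B`-module. -/
structure RightFaithfullyFlat (B : Type v) (M : Type w) [Ring B] [AddCommGroup M]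
    [Module Bᵐᵒᵖ M] : Prop where
  flat : ∀ (N N' : Type (max v w)) [AddCommGroup N] [AddCommGroup N'] [Module B N]
    [Module B N'] (f : N →ₗ[B] N'), Function.Injective f →
      Function.Injective (TensorOver.map (LinearMap.id : M →ₗ[Bᵐᵒᵖ] M) f)
  faithful : ∀ (N : Type (max v w)) [AddCommGroup N] [Module B N],
    Subsingleton (TensorOver B M N) → Subsingleton N

section Separable

variable (B A M : Type*) [Ring B] [Ring A] [AddCommGroup M] [Module B M] [Module Aᵐᵒᵖ M]
  [SMulCommClass B Aᵐᵒᵖ M]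

/-- The evaluation map `M ⊗_A ^*M → B`, `m ⊗ f ↦ f(m)`. -/
def evaluation : BimodHom B B (TensorOver A M (LeftDual B M)) B :=
  let ev : TensorOver A M (LeftDual B M) →+ B := TensorOver.lift
    (AddMonoidHom.mk' (fun x : M => AddMonoidHom.mk' (fun f : LeftDual B M => f x)
      (fun _ _ => rfl)) (fun x y => AddMonoidHom.ext fun f => map_add f x y)) (fun _ _ _ => rfl)
  { ev with
    map_smul' := fun b z => by
      change ev (b • z) = b • ev z
      induction z using TensorOver.induction with
      | tmul x f => exact map_smul f b x
      | add y z hy hz => simp only [smul_add, map_add, hy, hz]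
    map_op_smul' := fun b z => by
      change ev (op b • z) = op b • ev z
      induction z using TensorOver.induction with
      | tmul x f => rfl
      | add y z hy hz => simp only [smul_add, map_add, hy, hz] }

/-- `M` is a separable bimodule: the evaluation map `M ⊗_A ^*M → B` is a split epimorphism of
`B`-bimodules. -/
def IsSeparableBimodule : Prop :=
  ∃ σ : BimodHom B B B (TensorOver A M (LeftDual B M)), ∀ b : B, evaluation B A M (σ b) = b

end Separable

end ComatrixCoring

open ComatrixCoring

/-! Write `M` for `Σ`. To a coring endomorphism `φ` of `M^* ⊗_B M` one attaches the sub-bimodule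
`twist φ` of all `x ∈ S` with `φ(f x ⊗ u) = f ⊗ x(u)`. Clearly `twist φ · twist ψ ⊆ twist (φ ψ)`,
and `φ ↦ twist φ` will invert `Γ`.

For invertible `I`, write `1 = ∑ sₖ xₖ` with `sₖ ∈ I⁻¹` and `xₖ ∈ I`. Because `I I⁻¹ = B`, every `y
sₖ` with `y ∈ I` crosses the tensor sign. This makes `f ⊗ u ↦ ∑ f sₖ ⊗ xₖ(u)` balanced,
comultiplicative and independent of the decomposition (`Splitting.sum_tmul_eq`, `invToEnd_tmul`), so
that `invToAut` is a homomorphism. By `invToAut_bijective` it is bijective once `twist 1 ⊆ B` and `1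
∈ twist φ⁻¹ · twist φ` for every automorphism `φ`.

Both conditions are descent statements. A finite dual basis gives `S ≅ M ⊗_A M^*`, so a bilinear `φ`
is encoded by `w = ∑ eᵢ φ(eᵢ^* ⊗ eⱼ) eⱼ^*` in `S ⊗_B S`, and `x w = 1 ⊗ x` forces `x ∈ twist φ`. Let
`d(x) = x w - 1 ⊗ x`. Comultiplicativity of `φ` says that `id ⊗ d` kills `f w ∈ M^* ⊗_B S`
(`map_leftDefect_rightCoaction`); counitality says that multiplication sends `f w` to `f`
(`lift_rightCoaction`). If `M^*_B` is flat, `f w` therefore dies in `M^* ⊗_B S / ker d`, whence `f ∈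
M^* · twist φ`. Thus `M^* · twist φ = M^*` for all `φ`, and the ideal `twist φ⁻¹ · twist φ` of `B`
also generates `M^*`; faithfulness puts `1` in it. The case of `_B M` is the mirror image, with `w y
- y ⊗ 1` and `M`.

If `M` is separable, `B → S` has a `B`-bilinear retraction `E`
(`IsSeparableBimodule.exists_retraction`). Then `E ⊗ id` contracts the equation for `w` and takes
over the role of faithful flatness in every step. -/

namespace ComatrixCoring

/-! ### Functoriality and additivity of the balanced tensor product. -/

namespace TensorOver

variable {B M N P : Type*} [Ring B] [AddCommGroup M] [Module Bᵐᵒᵖ M] [AddCommGroup N] [Module B N]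
  [AddCommGroup P]

theorem map_map {M' N' M'' N'' : Type*} [AddCommGroup M'] [Module Bᵐᵒᵖ M'] [AddCommGroup N']
    [Module B N'] [AddCommGroup M''] [Module Bᵐᵒᵖ M''] [AddCommGroup N''] [Module B N'']
    (f' : M' →ₗ[Bᵐᵒᵖ] M'') (g' : N' →ₗ[B] N'') (f : M →ₗ[Bᵐᵒᵖ] M') (g : N →ₗ[B] N')
    (z : TensorOver B M N) : map f' g' (map f g z) = map (f' ∘ₗ f) (g' ∘ₗ g) z := by
  induction z using induction with
  | tmul m n => rfl
  | add x y hx hy => simp only [map_add, hx, hy]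

@[simp] theorem map_id (z : TensorOver B M N) :
    map (LinearMap.id : M →ₗ[Bᵐᵒᵖ] M) (LinearMap.id : N →ₗ[B] N) z = z := by
  induction z using induction with
  | tmul m n => rfl
  | add x y hx hy => rw [map_add, hx, hy]

theorem sub_tmul (m m' : M) (n : N) : tmul B (m - m') n = tmul B m n - tmul B m' n :=
  map_sub ((tmulHom B M N).flip n) m m'

theorem tmul_sub (m : M) (n n' : N) : tmul B m (n - n') = tmul B m n - tmul B m n' :=
  map_sub (tmulHom B M N m) n n'

theorem map_sub_right {M' N' : Type*} [AddCommGroup M'] [Module Bᵐᵒᵖ M'] [AddCommGroup N']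
    [Module B N'] (f : M →ₗ[Bᵐᵒᵖ] M') (g g' : N →ₗ[B] N') (z : TensorOver B M N) :
    map f (g - g') z = map f g z - map f g' z := by
  induction z using induction with
  | tmul m n => simp [tmul_sub]
  | add x y hx hy => simp only [map_add, hx, hy]; abel

theorem map_sub_left {M' N' : Type*} [AddCommGroup M'] [Module Bᵐᵒᵖ M'] [AddCommGroup N']
    [Module B N'] (f f' : M →ₗ[Bᵐᵒᵖ] M') (g : N →ₗ[B] N') (z : TensorOver B M N) :
    map (f - f') g z = map f g z - map f' g z := by
  induction z using induction with
  | tmul m n => simp [sub_tmul]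
  | add x y hx hy => simp only [map_add, hx, hy]; abel

theorem map_sum_right {ι M' N' : Type*} [AddCommGroup M'] [Module Bᵐᵒᵖ M'] [AddCommGroup N']
    [Module B N'] (s : Finset ι) (f : M →ₗ[Bᵐᵒᵖ] M') (g : ι → N →ₗ[B] N')
    (z : TensorOver B M N) : map f (∑ i ∈ s, g i) z = ∑ i ∈ s, map f (g i) z := by
  induction z using induction with
  | tmul m n => simp [tmul_sum]
  | add x y hx hy => simp only [map_add, hx, hy, Finset.sum_add_distrib]

theorem map_sum_left {ι M' N' : Type*} [AddCommGroup M'] [Module Bᵐᵒᵖ M'] [AddCommGroup N']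
    [Module B N'] (s : Finset ι) (f : ι → M →ₗ[Bᵐᵒᵖ] M') (g : N →ₗ[B] N')
    (z : TensorOver B M N) : map (∑ i ∈ s, f i) g z = ∑ i ∈ s, map (f i) g z := by
  induction z using induction with
  | tmul m n => simp [sum_tmul]
  | add x y hx hy => simp only [map_add, hx, hy, Finset.sum_add_distrib]

end TensorOver

/-! ### The endomorphism ring as a bimodule -/

/-- The ring `End(M_A)`, regarded as a `B`-bimodule. -/
def EndBimodule (B A M : Type*) [Ring B] [Ring A] [AddCommGroup M] [Module B M]
    [Module Aᵐᵒᵖ M] [SMulCommClass B Aᵐᵒᵖ M] : Type _ :=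
  Module.End Aᵐᵒᵖ M

section EndBimodule

variable {B A M : Type*} [Ring B] [Ring A] [AddCommGroup M] [Module B M] [Module Aᵐᵒᵖ M]
  [SMulCommClass B Aᵐᵒᵖ M]

namespace EndBimodule

instance : Ring (EndBimodule B A M) := inferInstanceAs (Ring (Module.End Aᵐᵒᵖ M))

instance : FunLike (EndBimodule B A M) M M := inferInstanceAs (FunLike (Module.End Aᵐᵒᵖ M) M M)

instance : LinearMapClass (EndBimodule B A M) Aᵐᵒᵖ M M :=
  inferInstanceAs (LinearMapClass (Module.End Aᵐᵒᵖ M) Aᵐᵒᵖ M M)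

@[ext] theorem ext {s t : EndBimodule B A M} (h : ∀ x, s x = t x) : s = t := DFunLike.ext s t h

@[simp] theorem add_apply (s t : EndBimodule B A M) (x : M) : (s + t) x = s x + t x := rfl

@[simp] theorem mul_apply (s t : EndBimodule B A M) (x : M) : (s * t) x = s (t x) := rfl

@[simp] theorem one_apply (x : M) : (1 : EndBimodule B A M) x = x := rfl

theorem sum_apply {ι : Type*} (s : Finset ι) (t : ι → EndBimodule B A M) (x : M) :
    (∑ i ∈ s, t i) x = ∑ i ∈ s, t i x :=
  LinearMap.sum_apply (M₂ := M) s t x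

variable (B A M) in
/-- The structure map of the ring extension `B → End(M_A)`. -/
def ofBase : B →+* EndBimodule B A M := endExtension B A M

instance : Module B (EndBimodule B A M) := Module.compHom (EndBimodule B A M) (ofBase B A M)

instance : Module Bᵐᵒᵖ (EndBimodule B A M) :=
  Module.compHom (EndBimodule B A M) (RingHom.op (ofBase B A M))

theorem smul_def (b : B) (s : EndBimodule B A M) : b • s = ofBase B A M b * s := rfl

theorem op_smul_def (b : B) (s : EndBimodule B A M) : op b • s = s * ofBase B A M b := rfl

@[simp] theorem smul_apply (b : B) (s : EndBimodule B A M) (x : M) : (b • s) x = b • s x := rfl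

@[simp] theorem op_smul_apply (b : B) (s : EndBimodule B A M) (x : M) :
    (op b • s) x = s (b • x) := rfl

instance : SMulCommClass B Bᵐᵒᵖ (EndBimodule B A M) where
  smul_comm _ _ _ := rfl

instance : SMulCommClass (EndBimodule B A M) Bᵐᵒᵖ (EndBimodule B A M) where
  smul_comm _ _ _ := rfl

instance : SMulCommClass B (EndBimodule B A M)ᵐᵒᵖ (EndBimodule B A M) where
  smul_comm _ _ _ := rfl

/-- The endomorphism `x ↦ u g(x)`. -/
def rankOne (u : M) (g : RightDual A M) : EndBimodule B A M :=
  (show M →ₗ[Aᵐᵒᵖ] M from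
    { toFun := fun x => op (g x) • u
      map_add' := fun x y => by rw [map_add, MulOpposite.op_add, add_smul]
      map_smul' := fun a x => by
        rw [map_smul, RingHom.id_apply, ← mul_smul]
        rfl })

@[simp] theorem rankOne_apply (u : M) (g : RightDual A M) (x : M) :
    (rankOne u g : EndBimodule B A M) x = op (g x) • u := rfl

theorem mul_rankOne (s : EndBimodule B A M) (u : M) (g : RightDual A M) :
    s * rankOne u g = rankOne (s u) g := by
  ext x
  simp

theorem rankOne_mul (s : EndBimodule B A M) (u : M) (g : RightDual A M) :
    rankOne u g * s = rankOne u (g.comp s) := rfl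

/-- `rankOne` as a function of the functional. -/
def rankOneLeft (u : M) : RightDual A M →ₗ[Bᵐᵒᵖ] EndBimodule B A M where
  toFun := rankOne u
  map_add' g h := by ext x; simp [add_smul]
  map_smul' _ _ := rfl

/-- `rankOne` as a function of the vector. -/
def rankOneRight (g : RightDual A M) : M →ₗ[B] EndBimodule B A M where
  toFun u := rankOne u g
  map_add' u v := by ext x; simp
  map_smul' b u := by ext x; exact (smul_comm b _ u).symm

@[simp] theorem rankOneLeft_apply (u : M) (g : RightDual A M) :
    (rankOneLeft u : _ →ₗ[Bᵐᵒᵖ] EndBimodule B A M) g = rankOne u g := rfl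

@[simp] theorem rankOneRight_apply (u : M) (g : RightDual A M) :
    (rankOneRight g : _ →ₗ[B] EndBimodule B A M) u = rankOne u g := rfl

theorem op_smul_rankOne (a : A) (u : M) (g : RightDual A M) :
    (rankOne (op a • u) g : EndBimodule B A M) = rankOne u (a • g) := by
  ext x
  simp [mul_smul]

/-- The dual basis identity, read in `S`. Inserting this expression for `1` is how elements of `S`
are reduced to rank-one operators throughout. -/
theorem sum_rankOne (D : DualBasis A M) :
    ∑ i, (rankOne (D.vec i) (D.covec i) : EndBimodule B A M) = 1 := by
  ext x
  rw [sum_apply]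
  exact D.sum_eq x

/-- Precomposition `s ↦ f s`. -/
def compLeft (f : RightDual A M) : EndBimodule B A M →ₗ[Bᵐᵒᵖ] RightDual A M where
  toFun s := f.comp s
  map_add' s t := by ext x; exact map_add f _ _
  map_smul' _ _ := rfl

/-- Evaluation `s ↦ s(u)`. -/
def evalAt (u : M) : EndBimodule B A M →ₗ[B] M where
  toFun s := s u
  map_add' _ _ := rfl
  map_smul' _ _ := rfl

@[simp] theorem compLeft_apply (f : RightDual A M) (s : EndBimodule B A M) :
    compLeft f s = f.comp s := rfl

@[simp] theorem evalAt_apply (u : M) (s : EndBimodule B A M) : evalAt u s = s u := rfl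

theorem comp_rankOne (f : RightDual A M) (u : M) (g : RightDual A M) :
    f.comp (rankOne u g : EndBimodule B A M) = f u • g := by
  ext x
  exact map_smul f (op (g x)) u

/-- The map `M^* ⊗_B M → S ⊗_B S`, `h ⊗ u ↦ v h ⊗ u g`. -/
def sandwich (v : M) (g : RightDual A M) :
    Comatrix B A M →+ TensorOver B (EndBimodule B A M) (EndBimodule B A M) :=
  TensorOver.map (rankOneLeft v) (rankOneRight g)

@[simp] theorem sandwich_tmul (v : M) (g h : RightDual A M) (u : M) :
    sandwich v g (TensorOver.tmul B h u) = TensorOver.tmul B (rankOne v h) (rankOne u g) := rfl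

theorem sandwich_op_smul (a : A) (v : M) (g : RightDual A M) (c : Comatrix B A M) :
    sandwich (op a • v) g c = sandwich v g (a • c) := by
  induction c using TensorOver.induction with
  | tmul h u => simp [op_smul_rankOne]
  | add x y hx hy => simp only [smul_add, map_add, hx, hy]

theorem sandwich_smul (a : A) (v : M) (g : RightDual A M) (c : Comatrix B A M) :
    sandwich v (a • g) c = sandwich v g (op a • c) := by
  induction c using TensorOver.induction with
  | tmul h u => simp [op_smul_rankOne]
  | add x y hx hy => simp only [smul_add, map_add, hx, hy]

/-- The outer factors `v` and `g` carry the outer `S`-actions, while by the two preceding lemmas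
scalars of `A` pass between them and the inner tensor: `sandwich` models `M ⊗_A (M^* ⊗_B M) ⊗_A M^*`
inside `S ⊗_B S`. -/
theorem smul_sandwich (s : EndBimodule B A M) (v : M) (g : RightDual A M)
    (c : Comatrix B A M) : s • sandwich v g c = sandwich (s v) g c := by
  induction c using TensorOver.induction with
  | tmul h u => simp [mul_rankOne]
  | add x y hx hy => simp only [smul_add, map_add, hx, hy]

theorem op_smul_sandwich (s : EndBimodule B A M) (v : M) (g : RightDual A M)
    (c : Comatrix B A M) : op s • sandwich v g c = sandwich v (g.comp s) c := by
  induction c using TensorOver.induction with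
  | tmul h u => simp [rankOne_mul]
  | add x y hx hy => simp only [smul_add, map_add, hx, hy]

theorem sandwich_add_left (v v' : M) (g : RightDual A M) (c : Comatrix B A M) :
    sandwich (v + v') g c = sandwich v g c + sandwich v' g c := by
  induction c using TensorOver.induction with
  | tmul h u =>
    simp only [sandwich_tmul, ← TensorOver.add_tmul, ← rankOneRight_apply, ← map_add]
  | add x y hx hy => simp only [map_add, hx, hy]; abel

theorem sandwich_add_right (v : M) (g g' : RightDual A M) (c : Comatrix B A M) :
    sandwich v (g + g') c = sandwich v g c + sandwich v g' c := by
  induction c using TensorOver.induction with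
  | tmul h u =>
    simp only [sandwich_tmul, ← TensorOver.tmul_add, ← rankOneLeft_apply, ← map_add]
  | add x y hx hy => simp only [map_add, hx, hy]; abel

/-- The map `v ↦ (h ⊗ u ↦ v h ⊗ u g)`, evaluated at an element of `M^* ⊗_B M`. -/
def sandwichLeft (g : RightDual A M) (c : Comatrix B A M) :
    M →ₗ[B] TensorOver B (EndBimodule B A M) (EndBimodule B A M) where
  toFun v := sandwich v g c
  map_add' v v' := sandwich_add_left v v' g c
  map_smul' b v := (smul_sandwich (ofBase B A M b) v g c).symm

/-- The map `g ↦ (h ⊗ u ↦ v h ⊗ u g)`, evaluated at an element of `M^* ⊗_B M`. -/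
def sandwichRight (v : M) (c : Comatrix B A M) :
    RightDual A M →ₗ[Bᵐᵒᵖ] TensorOver B (EndBimodule B A M) (EndBimodule B A M) where
  toFun g := sandwich v g c
  map_add' g g' := sandwich_add_right v g g' c
  map_smul' b g := (op_smul_sandwich (ofBase B A M (unop b)) v g c).symm

@[simp] theorem sandwichLeft_apply (v : M) (g : RightDual A M) (c : Comatrix B A M) :
    sandwichLeft g c v = sandwich v g c := rfl

@[simp] theorem sandwichRight_apply (v : M) (g : RightDual A M) (c : Comatrix B A M) :
    sandwichRight v c g = sandwich v g c := rfl

/-- The map `S ⊗_B S → M^* ⊗_B M`, `s ⊗ t ↦ f s ⊗ t(u)`. -/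
def evalBoth (f : RightDual A M) (u : M) :
    TensorOver B (EndBimodule B A M) (EndBimodule B A M) →+ Comatrix B A M :=
  TensorOver.map (compLeft f) (evalAt u)

@[simp] theorem evalBoth_tmul (f : RightDual A M) (u : M) (s t : EndBimodule B A M) :
    evalBoth f u (TensorOver.tmul B s t) = TensorOver.tmul B (f.comp s) (t u) := rfl

theorem evalBoth_smul (f : RightDual A M) (u : M) (s : EndBimodule B A M)
    (z : TensorOver B (EndBimodule B A M) (EndBimodule B A M)) :
    evalBoth f u (s • z) = evalBoth (f.comp s) u z := by
  induction z using TensorOver.induction with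
  | tmul t t' => rfl
  | add x y hx hy => simp only [smul_add, map_add, hx, hy]

theorem evalBoth_op_smul (f : RightDual A M) (u : M) (s : EndBimodule B A M)
    (z : TensorOver B (EndBimodule B A M) (EndBimodule B A M)) :
    evalBoth f u (op s • z) = evalBoth f (s u) z := by
  induction z using TensorOver.induction with
  | tmul t t' => rfl
  | add x y hx hy => simp only [smul_add, map_add, hx, hy]

theorem evalBoth_sandwich (f : RightDual A M) (u v : M) (g : RightDual A M)
    (c : Comatrix B A M) : evalBoth f u (sandwich v g c) = f v • op (g u) • c := by
  induction c using TensorOver.induction with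
  | tmul h x => simp [comp_rankOne]
  | add x y hx hy => simp only [smul_add, map_add, hx, hy]

end EndBimodule

end EndBimodule

/-! ### Endomorphisms crossing the tensor sign of the comatrix coring. -/

section Comatrix

variable {B A M : Type*} [Ring B] [Ring A] [AddCommGroup M] [Module B M] [Module Aᵐᵒᵖ M]
  [SMulCommClass B Aᵐᵒᵖ M]

open EndBimodule

/-- The tensor `f s ⊗ u` as a biadditive function of `s` and `u`. -/
def compTmul (f : RightDual A M) : Module.End Aᵐᵒᵖ M →+ M →+ Comatrix B A M :=
  (TensorOver.tmulHom B (RightDual A M) M).comp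
    (compLeft f : EndBimodule B A M →ₗ[Bᵐᵒᵖ] RightDual A M).toAddMonoidHom

@[simp] theorem compTmul_apply (f : RightDual A M) (s : Module.End Aᵐᵒᵖ M) (u : M) :
    (compTmul f s u : Comatrix B A M) = TensorOver.tmul B (f.comp s) u := rfl

/-- An element of the image of `B` moves across the tensor sign. -/
theorem tmul_comp_of_mem_one {z : Module.End Aᵐᵒᵖ M}
    (hz : z ∈ (1 : SubBimodule (endExtension B A M))) (f : RightDual A M) (u : M) :
    TensorOver.tmul B (f.comp z) u = TensorOver.tmul B f (z u) := by
  obtain ⟨b, rfl⟩ := hz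
  exact TensorOver.balanced f b u

/-! ### Splittings of invertible sub-bimodules -/

theorem exists_sum_of_mem_mul {I J : SubBimodule (endExtension B A M)} {z : Module.End Aᵐᵒᵖ M}
    (hz : z ∈ I * J) : ∃ (n : ℕ) (s x : Fin n → Module.End Aᵐᵒᵖ M),
      (∀ k, s k ∈ I) ∧ (∀ k, x k ∈ J) ∧ ∑ k, s k * x k = z := by
  refine SubBimodule.mul_induction hz (fun s hs x hx => ?_) ?_
  · exact ⟨1, fun _ => s, fun _ => x, fun _ => hs, fun _ => hx, by simp⟩
  · rintro _ _ ⟨n, s, x, hs, hx, rfl⟩ ⟨m, t, y, ht, hy, rfl⟩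
    refine ⟨n + m, Fin.append s t, Fin.append x y, fun k => ?_, fun k => ?_, ?_⟩
    · refine Fin.addCases (fun i => ?_) (fun i => ?_) k <;> simp [hs, ht]
    · refine Fin.addCases (fun i => ?_) (fun i => ?_) k <;> simp [hx, hy]
    · simp [Fin.sum_univ_add]

theorem one_mem_one : (1 : Module.End Aᵐᵒᵖ M) ∈ (1 : SubBimodule (endExtension B A M)) :=
  ⟨1, map_one _⟩

/-- A decomposition of `1` attached to a sub-bimodule: `1 = ∑ sₖ xₖ` with `x s ∈ B` for all
`x ∈ I` and all `s = sₖ`. -/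
structure Splitting (I : SubBimodule (endExtension B A M)) where
  size : ℕ
  s : Fin size → Module.End Aᵐᵒᵖ M
  x : Fin size → Module.End Aᵐᵒᵖ M
  x_mem : ∀ k, x k ∈ I
  mul_mem : ∀ y ∈ I, ∀ k, y * s k ∈ (1 : SubBimodule (endExtension B A M))
  sum_eq : ∑ k, s k * x k = 1

/-- The decomposition comes from `1 ∈ B = I⁻¹ I`; the other equation `I I⁻¹ = B` puts the products
`y sₖ` in `B`. -/
theorem nonempty_splitting (I : InvSubBimodule (endExtension B A M)) :
    Nonempty (Splitting (I : SubBimodule (endExtension B A M))) := by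
  have h : (1 : Module.End Aᵐᵒᵖ M) ∈
      ((I⁻¹ : InvSubBimodule (endExtension B A M)) : SubBimodule (endExtension B A M)) * I.1 := by
    rw [I.inv_mul]
    exact one_mem_one
  obtain ⟨n, s, x, hs, hx, h1⟩ := exists_sum_of_mem_mul h
  refine ⟨⟨n, s, x, hx, fun y hy k => ?_, h1⟩⟩
  rw [← I.mul_inv]
  exact SubBimodule.mul_mem_mul hy (hs k)

namespace Splitting

variable {I : SubBimodule (endExtension B A M)} (σ : Splitting I)

theorem sum_apply (u : M) : ∑ k, σ.s k (σ.x k u) = u := by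
  have h := LinearMap.congr_fun σ.sum_eq u
  rwa [LinearMap.sum_apply] at h

/-- Each `y sₗ` lies in `B`, hence moves to the right factor, where `∑ y sₗ xₗ = y`. Every later
property of the map `f ⊗ u ↦ ∑ f sₖ ⊗ xₖ(u)` rests on this cancellation. -/
theorem sum_tmul_comp_mul {y : Module.End Aᵐᵒᵖ M} (hy : y ∈ I) (f : RightDual A M) (u : M) :
    ∑ l, TensorOver.tmul B (f.comp (y * σ.s l)) (σ.x l u) = TensorOver.tmul B f (y u) := by
  conv_rhs => rw [← σ.sum_apply u, map_sum, TensorOver.tmul_sum]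
  exact Finset.sum_congr rfl fun l _ => tmul_comp_of_mem_one (σ.mul_mem _ hy l) f _

/-- Any decomposition of an endomorphism can be rewritten with the `sₖ` and `xₖ` of a
splitting. -/
theorem sum_tmul_eq {ι : Type*} [Fintype ι] {t y : ι → Module.End Aᵐᵒᵖ M} (hy : ∀ k, y k ∈ I)
    (f : RightDual A M) (u : M) :
    ∑ k, TensorOver.tmul B (f.comp (t k)) (y k u) =
      ∑ l, TensorOver.tmul B (f.comp ((∑ k, t k * y k) * σ.s l)) (σ.x l u) := by
  rw [Finset.sum_congr rfl fun k _ => (σ.sum_tmul_comp_mul (hy k) (f.comp (t k)) u).symm,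
    Finset.sum_comm]
  refine Finset.sum_congr rfl fun l _ => ?_
  rw [Finset.sum_mul]
  simp only [← compTmul_apply, map_sum, AddMonoidHom.finsetSum_apply]
  rfl

/-- The biadditive map `(f, u) ↦ ∑ f sₖ ⊗ xₖ(u)`. -/
def bihom : RightDual A M →+ M →+ Comatrix B A M :=
  AddMonoidHom.mk' (fun f => ∑ k, (compTmul f (σ.s k)).comp (σ.x k).toAddMonoidHom)
    (fun f g => by
      ext u
      simp only [AddMonoidHom.finsetSum_apply, AddMonoidHom.add_apply, ← Finset.sum_add_distrib]
      refine Finset.sum_congr rfl fun k _ => ?_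
      exact TensorOver.add_tmul (f.comp (σ.s k)) (g.comp (σ.s k)) (σ.x k u))

theorem bihom_apply (f : RightDual A M) (u : M) :
    σ.bihom f u = ∑ k, TensorOver.tmul B (f.comp (σ.s k)) (σ.x k u) := by
  simp [bihom, AddMonoidHom.finsetSum_apply]

/-- The elements `xₖ b` still lie in `I` and `∑ sₖ (xₖ b) = b`, so `sum_tmul_eq` carries `b` over to
the side of `f`. -/
theorem bihom_balanced (f : RightDual A M) (b : B) (u : M) :
    σ.bihom (op b • f) u = σ.bihom f (b • u) := by
  rw [bihom_apply, bihom_apply]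
  have h := σ.sum_tmul_eq (t := σ.s) (y := fun k => σ.x k * endExtension B A M b)
    (fun k => I.right_mem b (σ.x_mem k)) f u
  refine Eq.trans ?_ h.symm
  simp only [← mul_assoc]
  rw [← Finset.sum_mul, σ.sum_eq, one_mul]
  rfl

/-- The additive endomorphism `f ⊗ u ↦ ∑ f sₖ ⊗ xₖ(u)` of the comatrix coring. -/
def toAddHom : Comatrix B A M →+ Comatrix B A M := TensorOver.lift σ.bihom σ.bihom_balanced

theorem toAddHom_tmul (f : RightDual A M) (u : M) :
    σ.toAddHom (TensorOver.tmul B f u) = ∑ k, TensorOver.tmul B (f.comp (σ.s k)) (σ.x k u) :=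
  σ.bihom_apply f u

/-- The `A`-bilinear endomorphism `f ⊗ u ↦ ∑ f sₖ ⊗ xₖ(u)` of the comatrix coring. -/
def toBimodHom : BimodHom A A (Comatrix B A M) (Comatrix B A M) :=
  { σ.toAddHom with
    map_smul' := fun a z => by
      change σ.toAddHom (a • z) = a • σ.toAddHom z
      induction z using TensorOver.induction with
      | tmul f u =>
        rw [TensorOver.smul_tmul, toAddHom_tmul, toAddHom_tmul, Finset.smul_sum]
        rfl
      | add y z hy hz => simp only [smul_add, map_add, hy, hz]
    map_op_smul' := fun a z => by
      change σ.toAddHom (op a • z) = op a • σ.toAddHom z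
      induction z using TensorOver.induction with
      | tmul f u =>
        rw [TensorOver.op_smul_tmul, toAddHom_tmul, toAddHom_tmul, Finset.smul_sum]
        simp
      | add y z hy hz => simp only [smul_add, map_add, hy, hz] }

theorem toBimodHom_tmul (f : RightDual A M) (u : M) :
    σ.toBimodHom (TensorOver.tmul B f u) =
      ∑ k, TensorOver.tmul B (f.comp (σ.s k)) (σ.x k u) :=
  σ.toAddHom_tmul f u

end Splitting

/-- An endomorphism moves across the dual basis tensor. -/
theorem sum_tmul_vec_comp (D : DualBasis A M) (s x : Module.End Aᵐᵒᵖ M) (f : RightDual A M)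
    (u : M) :
    ∑ i, TensorOver.tmul A (TensorOver.tmul B f (s (D.vec i)))
        (TensorOver.tmul B ((D.covec i).comp x) u) =
      ∑ i, TensorOver.tmul A (TensorOver.tmul B f (D.vec i))
        (TensorOver.tmul B ((D.covec i).comp (s * x)) u) := by
  have h1 : ∀ i, TensorOver.tmul A (TensorOver.tmul B f (s (D.vec i)))
        (TensorOver.tmul B ((D.covec i).comp x) u) =
      ∑ j, TensorOver.tmul A (TensorOver.tmul B f (D.vec j))
        (TensorOver.tmul B ((D.covec j (s (D.vec i)) • D.covec i).comp x) u) := by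
    intro i
    conv_lhs => rw [← D.sum_eq (s (D.vec i)), TensorOver.tmul_sum, TensorOver.sum_tmul]
    refine Finset.sum_congr rfl fun j _ => ?_
    rw [← TensorOver.op_smul_tmul, TensorOver.balanced, TensorOver.smul_tmul]
    rfl
  rw [Finset.sum_congr rfl fun i _ => h1 i, Finset.sum_comm]
  refine Finset.sum_congr rfl fun j _ => ?_
  have h2 : (D.covec j).comp (s * x) =
      ∑ i, (D.covec j (s (D.vec i)) • D.covec i).comp x := by
    change ((D.covec j).comp s).comp x = _
    conv_lhs => rw [← D.sum_smul_covec ((D.covec j).comp s)]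
    exact map_sum (AddMonoidHom.mk' (fun g : RightDual A M => g.comp x) fun _ _ => rfl) _ _
  rw [← TensorOver.tmul_sum, h2, TensorOver.sum_tmul]

variable [Module.Finite Aᵐᵒᵖ M] [Module.Projective Aᵐᵒᵖ M]

theorem comul_eq (D : DualBasis A M) :
    Coring.comul (A := A) (C := Comatrix B A M) = comatrixComul B D :=
  comatrixComul_eq _ D

theorem comul_tmul (D : DualBasis A M) (f : RightDual A M) (x : M) :
    Coring.comul (A := A) (TensorOver.tmul B f x) =
      ∑ i, TensorOver.tmul A (TensorOver.tmul B f (D.vec i))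
        (TensorOver.tmul B (D.covec i) x) := by
  rw [comul_eq D, comatrixComul_tmul]

@[simp] theorem counit_tmul (f : RightDual A M) (x : M) :
    Coring.counit (A := A) (TensorOver.tmul B f x) = f x := rfl

/-! ### The sub-bimodule of a coring endomorphism -/

/-- The sub-bimodule of all `x` with `φ(f x ⊗ u) = f ⊗ x(u)`. -/
def twist (φ : CoringEnd A (Comatrix B A M)) : SubBimodule (endExtension B A M) where
  carrier := {x | ∀ (f : RightDual A M) (u : M),
    φ (TensorOver.tmul B (f.comp x) u) = TensorOver.tmul B f (x u)}
  add_mem' {x y} hx hy f u := by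
    have h := map_add φ.toBimodHom (TensorOver.tmul B (f.comp x) u) (TensorOver.tmul B (f.comp y) u)
    rw [← compTmul_apply, map_add, AddMonoidHom.add_apply, LinearMap.add_apply,
      TensorOver.tmul_add, ← hx, ← hy]
    exact h
  zero_mem' f u := by
    have h := map_zero φ.toBimodHom
    rw [← compTmul_apply, map_zero, LinearMap.zero_apply, TensorOver.tmul_zero]
    exact h
  neg_mem' {x} hx f u := by
    have h := map_neg φ.toBimodHom (TensorOver.tmul B (f.comp x) u)
    rw [← compTmul_apply, map_neg, LinearMap.neg_apply]
    refine h.trans ((congrArg Neg.neg (hx f u)).trans ?_)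
    exact (map_neg (TensorOver.tmulHom B (RightDual A M) M f) (x u)).symm
  left_mem' b x hx f u := (hx (op b • f) u).trans (TensorOver.balanced f b (x u))
  right_mem' b x hx f u :=
    (congrArg φ (TensorOver.balanced (f.comp x) b u)).trans (hx f (b • u))

/-- In `f x y ⊗ u` the map `ψ`, applied first, moves `y` across; then `φ` moves `x`. -/
theorem mul_mem_twist {φ ψ : CoringEnd A (Comatrix B A M)} {x y : Module.End Aᵐᵒᵖ M}
    (hx : x ∈ twist φ) (hy : y ∈ twist ψ) : x * y ∈ twist (φ * ψ) := fun f u =>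
  (congrArg φ (hy (f.comp x) u)).trans (hx f (y u))

theorem twist_mul_le {φ ψ : CoringEnd A (Comatrix B A M)} {z : Module.End Aᵐᵒᵖ M}
    (hz : z ∈ twist φ * twist ψ) : z ∈ twist (φ * ψ) :=
  SubBimodule.mul_induction hz (fun _ hx _ hy => mul_mem_twist hx hy) fun _ _ => add_mem

/-- Under `φ` itself such a `y` crosses the tensor sign from right to left. This is the form in
which the right defect of `φ` detects these elements. -/
theorem mem_twist_inv (φ : CoringAut A (Comatrix B A M)) {y : Module.End Aᵐᵒᵖ M} :
    y ∈ twist (φ⁻¹ : CoringAut A (Comatrix B A M)).1 ↔ ∀ (f : RightDual A M) (u : M),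
      φ.1 (TensorOver.tmul B f (y u)) = TensorOver.tmul B (f.comp y) u := by
  have h1 : ∀ c, φ.1 ((φ⁻¹ : CoringAut A (Comatrix B A M)).1 c) = c := fun c =>
    DFunLike.congr_fun φ.mul_inv c
  have h2 : ∀ c, (φ⁻¹ : CoringAut A (Comatrix B A M)).1 (φ.1 c) = c := fun c =>
    DFunLike.congr_fun φ.inv_mul c
  constructor
  · intro hy f u
    rw [← hy f u, h1]
  · intro hy f u
    rw [← hy f u, h2]

/-! ### The coring automorphism of an invertible sub-bimodule -/

namespace Splitting

variable {I : SubBimodule (endExtension B A M)} (σ : Splitting I)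

/-- The coring endomorphism `f ⊗ u ↦ ∑ f sₖ ⊗ xₖ(u)`. -/
def toCoringEnd : CoringEnd A (Comatrix B A M) :=
  { σ.toBimodHom with
    counit_comp := fun c => by
      change Coring.counit (A := A) (σ.toBimodHom c) = _
      induction c using TensorOver.induction with
      | tmul f u =>
        rw [toBimodHom_tmul, map_sum, counit_tmul]
        conv_rhs => rw [← σ.sum_apply u, map_sum]
        rfl
      | add y z hy hz => simp only [map_add, hy, hz]
    comul_comp := fun c => by
      change Coring.comul (A := A) (σ.toBimodHom c) =
        TensorOver.map σ.toBimodHom.right σ.toBimodHom.left (Coring.comul (A := A) c)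
      obtain ⟨D⟩ := nonempty_dualBasis A M
      induction c using TensorOver.induction with
      | tmul f u =>
        have h1 : ∀ i, TensorOver.map σ.toBimodHom.right σ.toBimodHom.left
            (TensorOver.tmul A (TensorOver.tmul B f (D.vec i))
              (TensorOver.tmul B (D.covec i) u)) =
            ∑ k, ∑ l, TensorOver.tmul A (TensorOver.tmul B (f.comp (σ.s k)) (σ.x k (D.vec i)))
              (TensorOver.tmul B ((D.covec i).comp (σ.s l)) (σ.x l u)) := fun i => by
          simp only [TensorOver.map_tmul, BimodHom.right_apply, BimodHom.left_apply,
            toBimodHom_tmul, TensorOver.sum_tmul]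
          exact Finset.sum_congr rfl fun k _ => TensorOver.tmul_sum _ _ _
        rw [toBimodHom_tmul, map_sum, comul_tmul D, map_sum, Finset.sum_congr rfl fun i _ => h1 i,
          Finset.sum_comm]
        refine Finset.sum_congr rfl fun k _ => ?_
        -- Each `xₖ` crosses the dual basis tensor and meets `sₗ`; since `xₖ sₗ ∈ B`, the sum over
        -- `l` then collapses to `eᵢ^* ⊗ xₖ(u)`.
        rw [comul_tmul D, Finset.sum_comm, Finset.sum_congr rfl fun l _ =>
          sum_tmul_vec_comp D (σ.x k) (σ.s l) (f.comp (σ.s k)) (σ.x l u), Finset.sum_comm]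
        refine Finset.sum_congr rfl fun i _ => ?_
        rw [← TensorOver.tmul_sum, σ.sum_tmul_comp_mul (σ.x_mem k)]
      | add y z hy hz => simp only [map_add, hy, hz] }

theorem toCoringEnd_tmul (f : RightDual A M) (u : M) :
    σ.toCoringEnd (TensorOver.tmul B f u) =
      ∑ k, TensorOver.tmul B (f.comp (σ.s k)) (σ.x k u) :=
  σ.toBimodHom_tmul f u

end Splitting

theorem CoringEnd.ext_tmul {φ ψ : CoringEnd A (Comatrix B A M)}
    (h : ∀ (f : RightDual A M) (u : M),
      φ (TensorOver.tmul B f u) = ψ (TensorOver.tmul B f u)) : φ = ψ :=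
  CoringEnd.ext fun c => DFunLike.congr_fun
    (TensorOver.hom_ext (f := φ.toAddMonoidHom) (g := ψ.toAddMonoidHom) h) c

/-- The coring endomorphism attached to an invertible sub-bimodule. -/
noncomputable def invToEnd (I : InvSubBimodule (endExtension B A M)) :
    CoringEnd A (Comatrix B A M) :=
  (nonempty_splitting I).some.toCoringEnd

/-- By `sum_tmul_eq` the right side depends only on `∑ sₖ xₖ`. Only the `xₖ` need to lie in `I`; the
`sₖ` are arbitrary in `S`. -/
theorem invToEnd_tmul (I : InvSubBimodule (endExtension B A M)) {ι : Type*} [Fintype ι]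
    {s x : ι → Module.End Aᵐᵒᵖ M} (hx : ∀ k, x k ∈ (I : SubBimodule (endExtension B A M)))
    (h : ∑ k, s k * x k = 1) (f : RightDual A M) (u : M) :
    invToEnd I (TensorOver.tmul B f u) = ∑ k, TensorOver.tmul B (f.comp (s k)) (x k u) := by
  rw [invToEnd, Splitting.toCoringEnd_tmul, Splitting.sum_tmul_eq (nonempty_splitting I).some hx,
    h]
  simp only [one_mul]

/-- The group homomorphism from invertible sub-bimodules to coring automorphisms. -/
noncomputable def invToAut :
    InvSubBimodule (endExtension B A M) →* CoringAut A (Comatrix B A M) :=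
  MonoidHom.toHomUnits
    { toFun := invToEnd
      map_one' := CoringEnd.ext_tmul fun f u => by
        -- The unit sub-bimodule admits the one-term decomposition `1 = 1 · 1`.
        rw [invToEnd_tmul 1 (ι := Unit) (s := 1) (x := 1) (fun _ => one_mem_one) (by simp)]
        simp
        rfl
      map_mul' := fun I J => CoringEnd.ext_tmul fun f u => by
        let σ := (nonempty_splitting I).some
        let τ := (nonempty_splitting J).some
        -- The splitting of `I` is inserted in the middle of the splitting of `J`: the `x`-parts
        -- then multiply into `I J`, and the resulting tensors are those of the map of `J` followed
        -- by that of `I`.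
        have h1 : ∑ p : Fin τ.size × Fin σ.size,
            (τ.s p.1 * σ.s p.2) * (σ.x p.2 * τ.x p.1) = 1 := by
          rw [Fintype.sum_prod_type, ← τ.sum_eq]
          refine Finset.sum_congr rfl fun l _ => ?_
          simp only [mul_assoc]
          rw [← Finset.mul_sum]
          simp only [← mul_assoc]
          rw [← Finset.sum_mul, σ.sum_eq, one_mul]
        rw [invToEnd_tmul (I * J)
            (fun p : Fin τ.size × Fin σ.size => SubBimodule.mul_mem_mul (σ.x_mem p.2) (τ.x_mem p.1)) h1,
          Fintype.sum_prod_type, CoringEnd.mul_apply, invToEnd_tmul J τ.x_mem τ.sum_eq]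
        refine Eq.trans ?_ (map_sum (invToEnd I).toBimodHom _ _).symm
        exact Finset.sum_congr rfl fun l _ =>
          (invToEnd_tmul I σ.x_mem σ.sum_eq (f.comp (τ.s l)) (τ.x l u)).symm }

theorem coe_invToAut (I : InvSubBimodule (endExtension B A M)) :
    (invToAut I : CoringEnd A (Comatrix B A M)) = invToEnd I := rfl

end Comatrix

section Canonical

variable {B A M : Type*} [Ring B] [Ring A] [AddCommGroup M] [Module B M] [Module Aᵐᵒᵖ M]
  [SMulCommClass B Aᵐᵒᵖ M]

open EndBimodule

/-! ### The canonical element of a bimodule endomorphism -/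

/-- The element of `S ⊗_B S` corresponding to a bilinear endomorphism of `M^* ⊗_B M`. -/
def canonical (D : DualBasis A M) (φ : BimodHom A A (Comatrix B A M) (Comatrix B A M)) :
    TensorOver B (EndBimodule B A M) (EndBimodule B A M) :=
  ∑ i, ∑ j, sandwich (D.vec i) (D.covec j) (φ (TensorOver.tmul B (D.covec i) (D.vec j)))

variable (D : DualBasis A M) (φ : BimodHom A A (Comatrix B A M) (Comatrix B A M))

theorem BimodHom.map_smul (a : A) (c : Comatrix B A M) : φ (a • c) = a • φ c :=
  φ.map_smul' a c

theorem BimodHom.map_op_smul (a : A) (c : Comatrix B A M) : φ (op a • c) = op a • φ c :=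
  φ.map_op_smul' a c

/-- Expand `f = ∑ f(eᵢ) eᵢ^*`; the scalars leave `φ` by left `A`-linearity and pass to `v`. -/
theorem sum_sandwich_covec (v : M) (f g : RightDual A M) (u : M) :
    ∑ i, sandwich (op (f (D.vec i)) • v) g (φ (TensorOver.tmul B (D.covec i) u)) =
      sandwich v g (φ (TensorOver.tmul B f u)) := by
  conv_rhs => rw [← D.sum_smul_covec f, TensorOver.sum_tmul, map_sum, map_sum]
  refine Finset.sum_congr rfl fun i _ => ?_
  rw [sandwich_op_smul, ← BimodHom.map_smul, TensorOver.smul_tmul]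

theorem sum_sandwich_vec (v : M) (f g : RightDual A M) (u : M) :
    ∑ j, sandwich v (D.covec j u • g) (φ (TensorOver.tmul B f (D.vec j))) =
      sandwich v g (φ (TensorOver.tmul B f u)) := by
  conv_rhs => rw [← D.sum_eq u, TensorOver.tmul_sum, map_sum, map_sum]
  refine Finset.sum_congr rfl fun i _ => ?_
  rw [sandwich_smul, ← BimodHom.map_op_smul, TensorOver.op_smul_tmul]

/-- The operator turns `eᵢ` into `v g(eᵢ)`, and `∑ g(eᵢ) eᵢ^* = g` then removes the sum over `i`. -/
theorem rankOne_smul_canonical (v : M) (g : RightDual A M) :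
    (rankOne v g : EndBimodule B A M) • canonical D φ =
      ∑ j, sandwich v (D.covec j) (φ (TensorOver.tmul B g (D.vec j))) := by
  rw [canonical, Finset.sum_comm, Finset.smul_sum]
  refine Finset.sum_congr rfl fun j _ => ?_
  rw [Finset.smul_sum, ← sum_sandwich_covec D]
  simp only [smul_sandwich, rankOne_apply]

theorem op_rankOne_smul_canonical (v : M) (g : RightDual A M) :
    op (rankOne v g : EndBimodule B A M) • canonical D φ =
      ∑ i, sandwich (D.vec i) g (φ (TensorOver.tmul B (D.covec i) v)) := by
  rw [canonical, Finset.smul_sum]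
  refine Finset.sum_congr rfl fun i _ => ?_
  rw [Finset.smul_sum, ← sum_sandwich_vec D]
  simp only [op_smul_sandwich, comp_rankOne]

/-- Evaluating at `f` and `u` produces the coefficients `f(eᵢ)` and `eⱼ^*(u)`, which bilinearity of
`φ` absorbs. So the canonical element determines `φ`, and equations in `S ⊗_B S` become equations
for `φ`. -/
theorem evalBoth_canonical (f : RightDual A M) (u : M) :
    evalBoth f u (canonical D φ) = φ (TensorOver.tmul B f u) := by
  have h : ∀ i, ∑ j, f (D.vec i) • op (D.covec j u) •
      φ (TensorOver.tmul B (D.covec i) (D.vec j)) =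
      φ (TensorOver.tmul B (f (D.vec i) • D.covec i) u) := fun i => by
    rw [← TensorOver.smul_tmul, BimodHom.map_smul, ← Finset.smul_sum]
    congr 1
    conv_rhs => rw [← D.sum_eq u, TensorOver.tmul_sum, map_sum]
    refine Finset.sum_congr rfl fun j _ => ?_
    rw [← BimodHom.map_op_smul, TensorOver.op_smul_tmul]
  simp only [canonical, map_sum, evalBoth_sandwich, h]
  rw [← map_sum, ← TensorOver.sum_tmul, D.sum_smul_covec]

/-! ### One-sided multiplications of the canonical element, and their defects. -/

variable (B A M) in
/-- The left `B`-linear map `x ↦ 1 ⊗ x`. -/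
def oneTmul :
    EndBimodule B A M →ₗ[B] TensorOver B (EndBimodule B A M) (EndBimodule B A M) where
  toFun x := TensorOver.tmul B 1 x
  map_add' := TensorOver.tmul_add 1
  map_smul' b x := by
    rw [← TensorOver.balanced, RingHom.id_apply, TensorOver.smul_tmul, smul_def, op_smul_def,
      mul_one, one_mul]

variable (B A M) in
/-- The right `B`-linear map `y ↦ y ⊗ 1`. -/
def tmulOne :
    EndBimodule B A M →ₗ[Bᵐᵒᵖ] TensorOver B (EndBimodule B A M) (EndBimodule B A M) where
  toFun y := TensorOver.tmul B y 1
  map_add' x y := TensorOver.add_tmul x y 1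
  map_smul' b y := by
    rw [← MulOpposite.op_unop b, TensorOver.balanced, RingHom.id_apply,
      TensorOver.op_smul_tmul, smul_def, op_smul_def, mul_one, one_mul]

/-- The left `B`-linear map `x ↦ x w`. -/
def smulRight (w : TensorOver B (EndBimodule B A M) (EndBimodule B A M)) :
    EndBimodule B A M →ₗ[B] TensorOver B (EndBimodule B A M) (EndBimodule B A M) where
  toFun x := x • w
  map_add' x y := add_smul x y _
  map_smul' b x := by
    rw [smul_def, mul_smul]
    generalize x • w = z
    induction z using TensorOver.induction with
    | tmul s t => rfl
    | add y z hy hz => simp only [smul_add, hy, hz]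

/-- The right `B`-linear map `y ↦ w y`. -/
def smulLeft (w : TensorOver B (EndBimodule B A M) (EndBimodule B A M)) :
    EndBimodule B A M →ₗ[Bᵐᵒᵖ] TensorOver B (EndBimodule B A M) (EndBimodule B A M) where
  toFun y := op y • w
  map_add' x y := by rw [MulOpposite.op_add, add_smul]
  map_smul' b y := by
    rw [← MulOpposite.op_unop b, op_smul_def, MulOpposite.op_mul, mul_smul]
    generalize op y • w = z
    induction z using TensorOver.induction with
    | tmul s t => rfl
    | add y z hy hz => simp only [smul_add, hy, hz]

@[simp] theorem oneTmul_apply (x : EndBimodule B A M) :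
    oneTmul B A M x = TensorOver.tmul B 1 x := rfl

@[simp] theorem tmulOne_apply (y : EndBimodule B A M) :
    tmulOne B A M y = TensorOver.tmul B y 1 := rfl

@[simp] theorem smulRight_apply (w : TensorOver B (EndBimodule B A M) (EndBimodule B A M))
    (x : EndBimodule B A M) : smulRight w x = x • w := rfl

@[simp] theorem smulLeft_apply (w : TensorOver B (EndBimodule B A M) (EndBimodule B A M))
    (y : EndBimodule B A M) : smulLeft w y = op y • w := rfl

/-- The left `B`-linear map `x ↦ x w - 1 ⊗ x`, for the canonical element `w`. -/
def leftDefect :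
    EndBimodule B A M →ₗ[B] TensorOver B (EndBimodule B A M) (EndBimodule B A M) :=
  smulRight (canonical D φ) - oneTmul B A M

/-- The right `B`-linear map `y ↦ w y - y ⊗ 1`, for the canonical element `w`. -/
def rightDefect :
    EndBimodule B A M →ₗ[Bᵐᵒᵖ] TensorOver B (EndBimodule B A M) (EndBimodule B A M) :=
  smulLeft (canonical D φ) - tmulOne B A M

/-- This form of `x ↦ x w` on rank-one operators matches the terms that `contractLeft` extracts from
`(φ ⊗ φ) Δ`. -/
theorem smulRight_canonical_comp (g : RightDual A M) :
    smulRight (canonical D φ) ∘ₗ rankOneRight g =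
      ∑ k, sandwichLeft (D.covec k) (φ (TensorOver.tmul B g (D.vec k))) := by
  ext v
  simp [rankOne_smul_canonical]

theorem smulLeft_canonical_comp (v : M) :
    smulLeft (canonical D φ) ∘ₗ rankOneLeft v =
      ∑ i, sandwichRight (D.vec i) (φ (TensorOver.tmul B (D.covec i) v)) := by
  ext g
  simp [op_rankOne_smul_canonical]

/-- The element `∑ⱼ φ(f ⊗ eⱼ) eⱼ^*` of `M^* ⊗_B S`. -/
def rightCoaction (f : RightDual A M) : TensorOver B (RightDual A M) (EndBimodule B A M) :=
  ∑ j, TensorOver.map LinearMap.id (rankOneRight (D.covec j))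
    (φ (TensorOver.tmul B f (D.vec j)))

/-- The element `∑ᵢ eᵢ φ(eᵢ^* ⊗ u)` of `S ⊗_B M`. -/
def leftCoaction (u : M) : TensorOver B (EndBimodule B A M) M :=
  ∑ i, TensorOver.map (rankOneLeft (D.vec i)) LinearMap.id
    (φ (TensorOver.tmul B (D.covec i) u))

/-- Thus `w` itself inherits the equations satisfied by the elements `eᵢ^* w`; the separable case
needs this. -/
theorem sum_map_rightCoaction :
    ∑ i, TensorOver.map (rankOneLeft (D.vec i)) LinearMap.id
      (rightCoaction D φ (D.covec i)) = canonical D φ := by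
  refine Finset.sum_congr rfl fun i _ => ?_
  rw [rightCoaction, map_sum]
  refine Finset.sum_congr rfl fun j _ => ?_
  rw [TensorOver.map_map]
  rfl

/-- The map `(g ⊗ v) ⊗ c ↦ g ⊗ (v c h)`. -/
def contractLeft (h : RightDual A M) :
    TensorOver A (Comatrix B A M) (Comatrix B A M) →+
      TensorOver B (RightDual A M) (TensorOver B (EndBimodule B A M) (EndBimodule B A M)) :=
  TensorOver.lift
    (AddMonoidHom.mk' (fun c => AddMonoidHom.mk'
      (fun c' => TensorOver.map LinearMap.id (sandwichLeft h c') c)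
      (fun c' c'' => by
        induction c using TensorOver.induction with
        | tmul f u => simp [TensorOver.tmul_add]
        | add x y hx hy => simp only [map_add, hx, hy]; abel))
      (fun c c' => by ext; simp))
    (fun c a c' => by
      change TensorOver.map LinearMap.id (sandwichLeft h c') (op a • c) =
        TensorOver.map LinearMap.id (sandwichLeft h (a • c')) c
      induction c using TensorOver.induction with
      | tmul f u => simp [sandwich_op_smul]
      | add x y hx hy => simp only [smul_add, map_add, hx, hy])

theorem contractLeft_tmul (h : RightDual A M) (c c' : Comatrix B A M) :
    contractLeft h (TensorOver.tmul A c c') =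
      TensorOver.map LinearMap.id (sandwichLeft h c') c := rfl

/-- The map `c ⊗ (g ⊗ v) ↦ (u c g) ⊗ v`. -/
def contractRight (u : M) :
    TensorOver A (Comatrix B A M) (Comatrix B A M) →+
      TensorOver B (TensorOver B (EndBimodule B A M) (EndBimodule B A M)) M :=
  TensorOver.lift
    (AddMonoidHom.mk' (fun c => AddMonoidHom.mk'
      (fun c' => TensorOver.map (sandwichRight u c) LinearMap.id c')
      (fun c' c'' => by simp))
      (fun c c' => by
        ext z
        change TensorOver.map (sandwichRight u (c + c')) LinearMap.id z =
          TensorOver.map (sandwichRight u c) LinearMap.id z +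
            TensorOver.map (sandwichRight u c') LinearMap.id z
        induction z using TensorOver.induction with
        | tmul f v => simp [TensorOver.add_tmul]
        | add x y hx hy => simp only [map_add, hx, hy]; abel))
    (fun c a c' => by
      change TensorOver.map (sandwichRight u (op a • c)) LinearMap.id c' =
        TensorOver.map (sandwichRight u c) LinearMap.id (a • c')
      induction c' using TensorOver.induction with
      | tmul f v => simp [sandwich_smul]
      | add x y hx hy => simp only [smul_add, map_add, hx, hy])

theorem contractRight_tmul (u : M) (c c' : Comatrix B A M) :
    contractRight u (TensorOver.tmul A c c') =
      TensorOver.map (sandwichRight u c) LinearMap.id c' := rfl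

/-! ### Consequences of comultiplicativity and counitality for the canonical element. -/

variable [Module.Finite Aᵐᵒᵖ M] [Module.Projective Aᵐᵒᵖ M]

/-- Contracting `∑ (g ⊗ eᵢ) ⊗ (eᵢ^* ⊗ v)` creates `∑ eᵢ eᵢ^* = 1` in the middle factor. -/
theorem contractLeft_comul (h : RightDual A M) (c : Comatrix B A M) :
    contractLeft h (Coring.comul (A := A) c) =
      TensorOver.map LinearMap.id (oneTmul B A M ∘ₗ rankOneRight h) c := by
  obtain ⟨D⟩ := nonempty_dualBasis A M
  induction c using TensorOver.induction with
  | tmul g v =>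
    simp only [comul_tmul D, map_sum, contractLeft_tmul, TensorOver.map_tmul,
      sandwichLeft_apply, sandwich_tmul, ← TensorOver.tmul_sum, ← TensorOver.sum_tmul,
      sum_rankOne]
    rfl
  | add x y hx hy => simp only [map_add, hx, hy]

theorem contractRight_comul (u : M) (c : Comatrix B A M) :
    contractRight u (Coring.comul (A := A) c) =
      TensorOver.map (tmulOne B A M ∘ₗ rankOneLeft u) LinearMap.id c := by
  obtain ⟨D⟩ := nonempty_dualBasis A M
  induction c using TensorOver.induction with
  | tmul g v =>
    simp only [comul_tmul D, map_sum, contractRight_tmul, TensorOver.map_tmul,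
      sandwichRight_apply, sandwich_tmul, ← TensorOver.tmul_sum, ← TensorOver.sum_tmul,
      sum_rankOne]
    rfl
  | add x y hx hy => simp only [map_add, hx, hy]

/-- The element `∑ⱼ φ(f ⊗ eⱼ) eⱼ^*` is equalized by `x ↦ x w` and `x ↦ 1 ⊗ x`. -/
theorem map_leftDefect_rightCoaction (ψ : CoringEnd A (Comatrix B A M)) (f : RightDual A M) :
    TensorOver.map LinearMap.id (leftDefect D ψ.toBimodHom)
      (rightCoaction D ψ.toBimodHom f) = 0 := by
  -- This is comultiplicativity of `ψ` on `f ⊗ eₖ`, contracted with `eₖ^*`.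
  have h1 : ∀ k, TensorOver.map LinearMap.id (oneTmul B A M ∘ₗ rankOneRight (D.covec k))
      (ψ.toBimodHom (TensorOver.tmul B f (D.vec k))) =
      ∑ j, TensorOver.map LinearMap.id (sandwichLeft (D.covec k)
        (ψ.toBimodHom (TensorOver.tmul B (D.covec j) (D.vec k))))
        (ψ.toBimodHom (TensorOver.tmul B f (D.vec j))) := fun k => by
    rw [← contractLeft_comul, ψ.comul_comp, comul_tmul D, map_sum, map_sum]
    rfl
  rw [leftDefect, TensorOver.map_sub_right, sub_eq_zero, rightCoaction, map_sum, map_sum]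
  simp only [TensorOver.map_map, LinearMap.id_comp, smulRight_canonical_comp,
    TensorOver.map_sum_right]
  rw [Finset.sum_comm]
  exact Finset.sum_congr rfl fun k _ => (h1 k).symm

/-- The element `∑ᵢ eᵢ φ(eᵢ^* ⊗ u)` is equalized by `y ↦ w y` and `y ↦ y ⊗ 1`. -/
theorem map_rightDefect_leftCoaction (ψ : CoringEnd A (Comatrix B A M)) (u : M) :
    TensorOver.map (rightDefect D ψ.toBimodHom) LinearMap.id
      (leftCoaction D ψ.toBimodHom u) = 0 := by
  -- Here comultiplicativity is used on `eᵢ^* ⊗ u` and contracted with `eᵢ`.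
  have h1 : ∀ i, TensorOver.map (tmulOne B A M ∘ₗ rankOneLeft (D.vec i)) LinearMap.id
      (ψ.toBimodHom (TensorOver.tmul B (D.covec i) u)) =
      ∑ j, TensorOver.map (sandwichRight (D.vec i)
        (ψ.toBimodHom (TensorOver.tmul B (D.covec i) (D.vec j)))) LinearMap.id
        (ψ.toBimodHom (TensorOver.tmul B (D.covec j) u)) := fun i => by
    rw [← contractRight_comul, ψ.comul_comp, comul_tmul D, map_sum, map_sum]
    rfl
  rw [rightDefect, TensorOver.map_sub_left, sub_eq_zero, leftCoaction, map_sum, map_sum]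
  simp only [TensorOver.map_map, LinearMap.id_comp, smulLeft_canonical_comp,
    TensorOver.map_sum_left]
  rw [Finset.sum_comm]
  exact Finset.sum_congr rfl fun k _ => (h1 k).symm

/-- Evaluating `x w = 1 ⊗ x` at `f` and `u` gives `ψ(f x ⊗ u) = f ⊗ x(u)`. -/
theorem mem_twist_of_leftDefect {ψ : CoringEnd A (Comatrix B A M)} {x : EndBimodule B A M}
    (hx : leftDefect D ψ.toBimodHom x = 0) :
    (show Module.End Aᵐᵒᵖ M from x) ∈ twist ψ := fun f u => by
  have h := congrArg (evalBoth f u) (sub_eq_zero.1 hx)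
  rw [smulRight_apply, evalBoth_smul, evalBoth_canonical] at h
  exact h

theorem mem_twist_inv_of_rightDefect {ψ : CoringAut A (Comatrix B A M)} {y : EndBimodule B A M}
    (hy : rightDefect D ψ.1.toBimodHom y = 0) :
    (show Module.End Aᵐᵒᵖ M from y) ∈ twist (ψ⁻¹ : CoringAut A (Comatrix B A M)).1 :=
  (mem_twist_inv ψ).2 fun f u => by
    have h := congrArg (evalBoth f u) (sub_eq_zero.1 hy)
    rw [smulLeft_apply, evalBoth_op_smul, evalBoth_canonical] at h
    exact h

/-- The multiplication `M^* ⊗_B S → M^*` recovers `f` from `∑ⱼ φ(f ⊗ eⱼ) eⱼ^*`. -/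
theorem lift_rightCoaction (ψ : CoringEnd A (Comatrix B A M)) (f : RightDual A M)
    (F : TensorOver B (RightDual A M) (EndBimodule B A M) →+ RightDual A M)
    (hF : ∀ g s, F (TensorOver.tmul B g s) = g.comp s) :
    F (rightCoaction D ψ.toBimodHom f) = f := by
  have h1 : ∀ (g : RightDual A M) (c : Comatrix B A M),
      F (TensorOver.map LinearMap.id (rankOneRight g) c) =
        Coring.counit (A := A) c • g := fun g c => by
    induction c using TensorOver.induction with
    | tmul h u => rw [TensorOver.map_tmul, hF, rankOneRight_apply, comp_rankOne]; rfl
    | add x y hx hy => rw [map_add, map_add, hx, hy, map_add, add_smul]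
  rw [rightCoaction, map_sum]
  simp only [h1, ψ.counit_comp]
  exact D.sum_smul_covec f

/-- Evaluation turns the inner tensors into their counits, which `ψ` preserves; what remains is `∑
eᵢ eᵢ^*(u) = u`. -/
theorem lift_leftCoaction (ψ : CoringEnd A (Comatrix B A M)) (u : M)
    (F : TensorOver B (EndBimodule B A M) M →+ M)
    (hF : ∀ s v, F (TensorOver.tmul B s v) = s v) :
    F (leftCoaction D ψ.toBimodHom u) = u := by
  have h1 : ∀ (v : M) (c : Comatrix B A M),
      F (TensorOver.map (rankOneLeft v) LinearMap.id c) =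
        op (Coring.counit (A := A) c) • v := fun v c => by
    induction c using TensorOver.induction with
    | tmul h u => rw [TensorOver.map_tmul, hF]; rfl
    | add x y hx hy => rw [map_add, map_add, hx, hy, map_add, MulOpposite.op_add, add_smul]
  rw [leftCoaction, map_sum]
  simp only [h1, ψ.counit_comp]
  exact D.sum_eq u

end Canonical

/-! ### Faithful flatness in smaller universes -/

section Flat

variable {B : Type u} [Ring B]

/-- Flatness is tested on modules of one fixed, possibly larger universe; conjugating by `ULift`
brings it down to where `S` and its quotients live. -/
theorem RightFaithfullyFlat.map_injective {P : Type (max v w)} [AddCommGroup P] [Module Bᵐᵒᵖ P]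
    (h : RightFaithfullyFlat.{u, max v w} B P) {N N' : Type w} [AddCommGroup N] [Module B N]
    [AddCommGroup N'] [Module B N'] (f : N →ₗ[B] N') (hf : Function.Injective f) :
    Function.Injective (TensorOver.map (LinearMap.id : P →ₗ[Bᵐᵒᵖ] P) f) := by
  let e : ULift.{max u v} N ≃ₗ[B] N := ULift.moduleEquiv
  let e' : ULift.{max u v} N' ≃ₗ[B] N' := ULift.moduleEquiv
  have h1 := h.flat (ULift.{max u v} N) (ULift.{max u v} N') (e'.symm ∘ₗ f ∘ₗ e)
    (e'.symm.injective.comp (hf.comp e.injective))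
  refine (injective_iff_map_eq_zero _).2 fun t ht => ?_
  have h2 : TensorOver.map (LinearMap.id : P →ₗ[Bᵐᵒᵖ] P) e.symm.toLinearMap t = 0 := by
    refine h1 ?_
    rw [map_zero, TensorOver.map_map]
    have h3 : (e'.symm ∘ₗ f ∘ₗ e) ∘ₗ e.symm.toLinearMap = e'.symm.toLinearMap ∘ₗ f := by
      ext x; simp
    rw [h3, ← TensorOver.map_map, ht, map_zero]
  have h4 := congrArg (TensorOver.map (LinearMap.id : P →ₗ[Bᵐᵒᵖ] P) e.toLinearMap) h2
  rw [TensorOver.map_map, map_zero] at h4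
  simpa using h4

/-- By flatness `P ⊗ B z` embeds in `P ⊗ N`, where its generators `p ⊗ b z = p b ⊗ z` vanish;
faithfulness then gives `B z = 0`. -/
theorem RightFaithfullyFlat.eq_zero {P : Type (max v w)} [AddCommGroup P] [Module Bᵐᵒᵖ P]
    (h : RightFaithfullyFlat.{u, max v w} B P) {N : Type w} [AddCommGroup N] [Module B N] {z : N}
    (hz : ∀ p : P, TensorOver.tmul B p z = 0) : z = 0 := by
  let K : Submodule B N := Submodule.span B {z}
  let e : ULift.{max u v} K ≃ₗ[B] K := ULift.moduleEquiv
  have h1 : ∀ t : TensorOver B P (ULift.{max u v} K), t = 0 := by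
    intro t
    refine (injective_iff_map_eq_zero _).1 (h.flat (ULift.{max u v} K) (ULift.{max u v} N)
      ((ULift.moduleEquiv (R := B) (M := N)).symm ∘ₗ K.subtype ∘ₗ e)
      ((ULift.moduleEquiv (R := B) (M := N)).symm.injective.comp
        (K.injective_subtype.comp e.injective))) t ?_
    rw [← LinearMap.id_comp (LinearMap.id : P →ₗ[Bᵐᵒᵖ] P), ← TensorOver.map_map]
    refine (congrArg (TensorOver.map _ _) ?_).trans (map_zero (TensorOver.map _ _))
    induction t using TensorOver.induction with
    | tmul p x =>
      obtain ⟨⟨_, hx⟩⟩ := x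
      obtain ⟨b, rfl⟩ := Submodule.mem_span_singleton.1 hx
      exact (TensorOver.balanced p b z).symm.trans (hz _)
    | add x y hx hy => rw [map_add, hx, hy, add_zero]
  have h2 := h.faithful (ULift.{max u v} K) ⟨fun x y => (h1 x).trans (h1 y).symm⟩
  have h3 : (⟨z, Submodule.mem_span_singleton_self z⟩ : K) = 0 :=
    e.symm.injective (Subsingleton.elim _ _)
  exact congrArg Subtype.val h3

theorem LeftFaithfullyFlat.map_injective {P : Type w} [AddCommGroup P] [Module B P]
    (h : LeftFaithfullyFlat.{u, w} B P) {N N' : Type w} [AddCommGroup N] [Module Bᵐᵒᵖ N]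
    [AddCommGroup N'] [Module Bᵐᵒᵖ N'] (f : N →ₗ[Bᵐᵒᵖ] N') (hf : Function.Injective f) :
    Function.Injective (TensorOver.map f (LinearMap.id : P →ₗ[B] P)) := by
  let e : ULift.{u} N ≃ₗ[Bᵐᵒᵖ] N := ULift.moduleEquiv
  let e' : ULift.{u} N' ≃ₗ[Bᵐᵒᵖ] N' := ULift.moduleEquiv
  have h1 := h.flat (ULift.{u} N) (ULift.{u} N') (e'.symm ∘ₗ f ∘ₗ e)
    (e'.symm.injective.comp (hf.comp e.injective))
  refine (injective_iff_map_eq_zero _).2 fun t ht => ?_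
  have h2 : TensorOver.map e.symm.toLinearMap (LinearMap.id : P →ₗ[B] P) t = 0 := by
    refine h1 ?_
    rw [map_zero, TensorOver.map_map]
    have h3 : (e'.symm ∘ₗ f ∘ₗ e) ∘ₗ e.symm.toLinearMap = e'.symm.toLinearMap ∘ₗ f := by
      ext x; simp
    rw [h3, ← TensorOver.map_map, ht, map_zero]
  have h4 := congrArg (TensorOver.map e.toLinearMap (LinearMap.id : P →ₗ[B] P)) h2
  rw [TensorOver.map_map, map_zero] at h4
  simpa using h4

/-- The mirror argument, with the cyclic right module `z B`. -/
theorem LeftFaithfullyFlat.eq_zero {P : Type w} [AddCommGroup P] [Module B P]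
    (h : LeftFaithfullyFlat.{u, w} B P) {N : Type w} [AddCommGroup N] [Module Bᵐᵒᵖ N] {z : N}
    (hz : ∀ p : P, TensorOver.tmul B z p = 0) : z = 0 := by
  let K : Submodule Bᵐᵒᵖ N := Submodule.span Bᵐᵒᵖ {z}
  let e : ULift.{u} K ≃ₗ[Bᵐᵒᵖ] K := ULift.moduleEquiv
  have h1 : ∀ t : TensorOver B (ULift.{u} K) P, t = 0 := by
    intro t
    refine (injective_iff_map_eq_zero _).1 (h.flat (ULift.{u} K) (ULift.{u} N)
      ((ULift.moduleEquiv (R := Bᵐᵒᵖ) (M := N)).symm ∘ₗ K.subtype ∘ₗ e)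
      ((ULift.moduleEquiv (R := Bᵐᵒᵖ) (M := N)).symm.injective.comp
        (K.injective_subtype.comp e.injective))) t ?_
    rw [← LinearMap.id_comp (LinearMap.id : P →ₗ[B] P), ← TensorOver.map_map]
    refine (congrArg (TensorOver.map _ _) ?_).trans (map_zero (TensorOver.map _ _))
    induction t using TensorOver.induction with
    | tmul x p =>
      obtain ⟨⟨_, hx⟩⟩ := x
      obtain ⟨b, rfl⟩ := Submodule.mem_span_singleton.1 hx
      exact (TensorOver.balanced z (unop b) p).trans (hz _)
    | add x y hx hy => rw [map_add, hx, hy, add_zero]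
  have h2 := h.faithful (ULift.{u} K) ⟨fun x y => (h1 x).trans (h1 y).symm⟩
  have h3 : (⟨z, Submodule.mem_span_singleton_self z⟩ : K) = 0 :=
    e.symm.injective (Subsingleton.elim _ _)
  exact congrArg Subtype.val h3

end Flat

section Generation

variable {B A M : Type*} [Ring B] [Ring A] [AddCommGroup M] [Module B M] [Module Aᵐᵒᵖ M]
  [SMulCommClass B Aᵐᵒᵖ M]

open EndBimodule

/-! ### Sub-bimodules generating `M` or its dual -/

/-- The subgroup `M^* I` of `M^*`. -/
def dualMul (I : SubBimodule (endExtension B A M)) : AddSubgroup (RightDual A M) :=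
  AddSubgroup.closure {g | ∃ h : RightDual A M, ∃ x ∈ I, g = h.comp x}

/-- The subgroup `I M` of `M`. -/
def mulVec (I : SubBimodule (endExtension B A M)) : AddSubgroup M :=
  AddSubgroup.closure {y | ∃ x ∈ I, ∃ v : M, y = x v}

theorem comp_mem_dualMul {I : SubBimodule (endExtension B A M)} (h : RightDual A M)
    {x : Module.End Aᵐᵒᵖ M} (hx : x ∈ I) : h.comp x ∈ dualMul I :=
  AddSubgroup.subset_closure ⟨h, x, hx, rfl⟩

theorem apply_mem_mulVec {I : SubBimodule (endExtension B A M)} {x : Module.End Aᵐᵒᵖ M}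
    (hx : x ∈ I) (v : M) : x v ∈ mulVec I :=
  AddSubgroup.subset_closure ⟨x, hx, v, rfl⟩

/-- `M^* (I J)` contains `(M^* I) J`, and `(M^* I) J = M^* J = M^*`. -/
theorem dualMul_mul {I J : SubBimodule (endExtension B A M)} (hI : dualMul I = ⊤)
    (hJ : dualMul J = ⊤) : dualMul (I * J) = ⊤ := by
  refine top_le_iff.1 (hJ.ge.trans ((AddSubgroup.closure_le _).2 ?_))
  rintro _ ⟨h, y, hy, rfl⟩
  have h1 : dualMul I ≤ (dualMul (I * J)).comap
      (AddMonoidHom.mk' (fun g : RightDual A M => g.comp y) fun _ _ => rfl) := by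
    refine (AddSubgroup.closure_le _).2 ?_
    rintro _ ⟨g, x, hx, rfl⟩
    exact comp_mem_dualMul g (SubBimodule.mul_mem_mul hx hy)
  exact h1 (hI ▸ AddSubgroup.mem_top h)

theorem mulVec_mul {I J : SubBimodule (endExtension B A M)} (hI : mulVec I = ⊤)
    (hJ : mulVec J = ⊤) : mulVec (I * J) = ⊤ := by
  refine top_le_iff.1 (hI.ge.trans ((AddSubgroup.closure_le _).2 ?_))
  rintro _ ⟨x, hx, v, rfl⟩
  have h1 : mulVec J ≤ (mulVec (I * J)).comap x.toAddMonoidHom := by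
    refine (AddSubgroup.closure_le _).2 ?_
    rintro _ ⟨y, hy, v, rfl⟩
    exact apply_mem_mulVec (SubBimodule.mul_mem_mul hx hy) v
  exact h1 (hJ ▸ AddSubgroup.mem_top v)

/-- A sub-bimodule as a left submodule of the endomorphism ring. -/
def SubBimodule.toLeft (I : SubBimodule (endExtension B A M)) :
    Submodule B (EndBimodule B A M) where
  carrier := {x | (show Module.End Aᵐᵒᵖ M from x) ∈ I}
  add_mem' hx hy := I.add_mem' hx hy
  zero_mem' := I.zero_mem'
  smul_mem' b _ hx := I.left_mem b hx

/-- A sub-bimodule as a right submodule of the endomorphism ring. -/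
def SubBimodule.toRight (I : SubBimodule (endExtension B A M)) :
    Submodule Bᵐᵒᵖ (EndBimodule B A M) where
  carrier := {x | (show Module.End Aᵐᵒᵖ M from x) ∈ I}
  add_mem' hx hy := I.add_mem' hx hy
  zero_mem' := I.zero_mem'
  smul_mem' b _ hx := I.right_mem (unop b) hx

variable (B A M) in
/-- The multiplication `M^* ⊗_B S → M^*`. -/
def dualAct : TensorOver B (RightDual A M) (EndBimodule B A M) →+ RightDual A M :=
  TensorOver.lift
    (AddMonoidHom.mk' (fun f => (compLeft f : EndBimodule B A M →ₗ[Bᵐᵒᵖ] _).toAddMonoidHom)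
      fun _ _ => rfl)
    fun _ _ _ => rfl

variable (B A M) in
/-- The evaluation `S ⊗_B M → M`. -/
def vecAct : TensorOver B (EndBimodule B A M) M →+ M :=
  TensorOver.lift
    (AddMonoidHom.mk' (fun s : EndBimodule B A M =>
      AddMonoidHom.mk' (fun v : M => s v) (map_add s)) fun _ _ => rfl)
    fun _ _ _ => rfl

@[simp] theorem dualAct_tmul (f : RightDual A M) (s : EndBimodule B A M) :
    dualAct B A M (TensorOver.tmul B f s) = f.comp s := rfl

@[simp] theorem vecAct_tmul (s : EndBimodule B A M) (v : M) :
    vecAct B A M (TensorOver.tmul B s v) = s v := rfl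

/-- If `t` vanishes in `M^* ⊗_B S / K`, then its product lies in `M^* K`. -/
theorem dualAct_mem (K : Submodule B (EndBimodule B A M)) (T : AddSubgroup (RightDual A M))
    (hT : ∀ (f : RightDual A M), ∀ x ∈ K, f.comp x ∈ T)
    {t : TensorOver B (RightDual A M) (EndBimodule B A M)}
    (ht : TensorOver.map LinearMap.id K.mkQ t = 0) : dualAct B A M t ∈ T := by
  let F : RightDual A M → (EndBimodule B A M ⧸ K) →+ (RightDual A M ⧸ T) := fun f =>
    QuotientAddGroup.lift K.toAddSubgroup
      ((QuotientAddGroup.mk' T).comp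
        (compLeft f : EndBimodule B A M →ₗ[Bᵐᵒᵖ] _).toAddMonoidHom)
      fun x hx => (QuotientAddGroup.eq_zero_iff _).2 (hT f x hx)
  have hF : ∀ f x, F f (K.mkQ x) = QuotientAddGroup.mk' T (f.comp x) := fun _ _ => rfl
  -- Since `M^* K ⊆ T`, the multiplication descends to `M^* ⊗_B S / K → M^* / T`.
  let G : TensorOver B (RightDual A M) (EndBimodule B A M ⧸ K) →+ (RightDual A M ⧸ T) :=
    TensorOver.lift
      (AddMonoidHom.mk' F fun f g => AddMonoidHom.ext fun x => by
        obtain ⟨x, rfl⟩ := K.mkQ_surjective x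
        rw [AddMonoidHom.add_apply, hF, hF, hF, ← map_add]
        rfl)
      fun f b x => by
        obtain ⟨x, rfl⟩ := K.mkQ_surjective x
        change F (op b • f) _ = F f _
        rw [← map_smul, hF, hF]
        rfl
  have hG : ∀ t, G (TensorOver.map LinearMap.id K.mkQ t) =
      QuotientAddGroup.mk' T (dualAct B A M t) := fun t => by
    induction t using TensorOver.induction with
    | tmul f x => rfl
    | add x y hx hy => simp only [map_add, hx, hy]
  have h := hG t
  rw [ht, map_zero] at h
  exact (QuotientAddGroup.eq_zero_iff _).1 h.symm

/-- If `t` vanishes in `S / K ⊗_B M`, then its value lies in `K M`. -/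
theorem vecAct_mem (K : Submodule Bᵐᵒᵖ (EndBimodule B A M)) (T : AddSubgroup M)
    (hT : ∀ x ∈ K, ∀ v : M, x v ∈ T)
    {t : TensorOver B (EndBimodule B A M) M}
    (ht : TensorOver.map K.mkQ LinearMap.id t = 0) : vecAct B A M t ∈ T := by
  let F : M → (EndBimodule B A M ⧸ K) →+ (M ⧸ T) := fun v =>
    QuotientAddGroup.lift K.toAddSubgroup
      ((QuotientAddGroup.mk' T).comp
        (evalAt v : EndBimodule B A M →ₗ[B] _).toAddMonoidHom)
      fun x hx => (QuotientAddGroup.eq_zero_iff _).2 (hT x hx v)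
  have hF : ∀ v x, F v (K.mkQ x) = QuotientAddGroup.mk' T (x v) := fun _ _ => rfl
  let G : TensorOver B (EndBimodule B A M ⧸ K) M →+ (M ⧸ T) :=
    TensorOver.lift
      (AddMonoidHom.flip (AddMonoidHom.mk' F fun u v => AddMonoidHom.ext fun x => by
        obtain ⟨x, rfl⟩ := K.mkQ_surjective x
        rw [AddMonoidHom.add_apply, hF, hF, hF, ← map_add, map_add x]))
      fun x b v => by
        obtain ⟨x, rfl⟩ := K.mkQ_surjective x
        change F v (op b • K.mkQ x) = F (b • v) (K.mkQ x)
        rw [← map_smul, hF, hF]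
        rfl
  have hG : ∀ t, G (TensorOver.map K.mkQ LinearMap.id t) =
      QuotientAddGroup.mk' T (vecAct B A M t) := fun t => by
    induction t using TensorOver.induction with
    | tmul f x => rfl
    | add x y hx hy => simp only [map_add, hx, hy]
  have h := hG t
  rw [ht, map_zero] at h
  exact (QuotientAddGroup.eq_zero_iff _).1 h.symm

/-- Inserting `1 = ∑ eⱼ eⱼ^*` to the right of `z` lifts identities from `M^* ⊗_B M` to `M^* ⊗_B S`.
-/
theorem tmul_eq_sum_right (D : DualBasis A M) (f : RightDual A M) (z : EndBimodule B A M) :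
    TensorOver.tmul B f z = ∑ j, TensorOver.map LinearMap.id (rankOneRight (D.covec j))
      (TensorOver.tmul B f (z (D.vec j))) := by
  conv_lhs => rw [← mul_one z, ← sum_rankOne D, Finset.mul_sum, TensorOver.tmul_sum]
  simp only [mul_rankOne]
  rfl

theorem tmul_eq_sum_left (D : DualBasis A M) (z : EndBimodule B A M) (u : M) :
    TensorOver.tmul B z u = ∑ i, TensorOver.map (rankOneLeft (D.vec i)) LinearMap.id
      (TensorOver.tmul B ((D.covec i).comp z) u) := by
  conv_lhs => rw [← one_mul z, ← sum_rankOne D, Finset.sum_mul, TensorOver.sum_tmul]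
  rfl

end Generation

section Criterion

variable {B A M : Type*} [Ring B] [Ring A] [AddCommGroup M] [Module B M] [Module Aᵐᵒᵖ M]
  [SMulCommClass B Aᵐᵒᵖ M] [Module.Finite Aᵐᵒᵖ M] [Module.Projective Aᵐᵒᵖ M]

open EndBimodule

/-! ### A criterion for bijectivity -/

theorem twist_inv_mul_le_one
    (h1 : ∀ z : Module.End Aᵐᵒᵖ M, z ∈ twist (1 : CoringEnd A (Comatrix B A M)) →
      z ∈ (1 : SubBimodule (endExtension B A M)))
    (φ : CoringAut A (Comatrix B A M)) {z : Module.End Aᵐᵒᵖ M}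
    (hz : z ∈ twist (φ⁻¹ : CoringAut A (Comatrix B A M)).1 * twist φ.1) :
    z ∈ (1 : SubBimodule (endExtension B A M)) := by
  refine h1 z ?_
  have h := twist_mul_le hz
  rwa [φ.inv_mul] at h

/-- The two hypotheses make `twist φ` and `twist φ⁻¹` mutually inverse sub-bimodules, which supplies
the preimage of `φ`. The first one alone bounds the kernel. -/
theorem invToAut_bijective
    (h1 : ∀ z : Module.End Aᵐᵒᵖ M, z ∈ twist (1 : CoringEnd A (Comatrix B A M)) →
      z ∈ (1 : SubBimodule (endExtension B A M)))
    (h2 : ∀ φ : CoringAut A (Comatrix B A M), (1 : Module.End Aᵐᵒᵖ M) ∈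
      twist (φ⁻¹ : CoringAut A (Comatrix B A M)).1 * twist φ.1) :
    Function.Bijective
      (invToAut : InvSubBimodule (endExtension B A M) →* CoringAut A (Comatrix B A M)) := by
  have h3 : ∀ φ : CoringAut A (Comatrix B A M),
      twist (φ⁻¹ : CoringAut A (Comatrix B A M)).1 * twist φ.1 = 1 := fun φ => by
    ext z
    refine ⟨twist_inv_mul_le_one h1 φ, ?_⟩
    rintro ⟨b, rfl⟩
    simpa using SubBimodule.left_mem _ b (h2 φ)
  constructor
  · refine (injective_iff_map_eq_one _).2 fun I hI => ?_
    have h4 : ∀ J : InvSubBimodule (endExtension B A M), invToAut J = 1 →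
        ∀ x ∈ J.1, x ∈ (1 : SubBimodule (endExtension B A M)) := by
      intro J hJ x hx
      refine h1 x fun f u => ?_
      let σ := (nonempty_splitting J).some
      have h5 := congrArg (fun φ : CoringAut A (Comatrix B A M) =>
        φ.1 (TensorOver.tmul B (f.comp x) u)) hJ
      change invToEnd J (TensorOver.tmul B (f.comp x) u) = TensorOver.tmul B (f.comp x) u at h5
      rw [invToEnd_tmul J σ.x_mem σ.sum_eq] at h5
      exact h5.symm.trans (σ.sum_tmul_comp_mul hx f u)
    -- The kernel is a group, so `I⁻¹ ⊆ B` as well, and then `B = I I⁻¹ ⊆ I B ⊆ I`.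
    have h6 : ∀ x ∈ I⁻¹.1, x ∈ (1 : SubBimodule (endExtension B A M)) :=
      h4 I⁻¹ (by rw [map_inv, hI, inv_one])
    refine Units.ext (SubBimodule.ext fun x => ⟨h4 I hI x, fun hx => ?_⟩)
    change x ∈ (1 : SubBimodule (endExtension B A M)) at hx
    rw [← I.mul_inv] at hx
    refine SubBimodule.mul_induction hx (fun y hy z hz => ?_) fun _ _ => add_mem
    obtain ⟨b, rfl⟩ := h6 z hz
    exact SubBimodule.right_mem _ b hy
  · intro φ
    let I : InvSubBimodule (endExtension B A M) :=
      ⟨twist φ.1, twist (φ⁻¹ : CoringAut A (Comatrix B A M)).1,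
        by simpa using h3 φ⁻¹, h3 φ⟩
    refine ⟨I, Units.ext (CoringEnd.ext_tmul fun f u => ?_)⟩
    obtain ⟨n, s, x, hs, hx, h4⟩ := exists_sum_of_mem_mul (h2 φ)
    rw [coe_invToAut, invToEnd_tmul I hx h4]
    -- As `xₖ ∈ twist φ`, each term is `φ(f sₖ xₖ ⊗ u)`, and `∑ sₖ xₖ = 1`.
    have h5 : ∀ k, TensorOver.tmul B (f.comp (s k)) (x k u) =
        φ.1 (TensorOver.tmul B (f.comp (s k * x k)) u) := fun k => (hx k (f.comp (s k)) u).symm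
    simp only [h5]
    refine (map_sum φ.1.toBimodHom _ _).symm.trans (congrArg φ.1 ?_)
    simp only [← compTmul_apply, ← AddMonoidHom.finsetSum_apply, ← map_sum, h4]
    rfl

end Criterion

/-! ### The faithfully flat cases -/

section RightFlat

variable {B : Type u} {A : Type v} {M : Type w} [Ring B] [Ring A] [AddCommGroup M] [Module B M]
  [Module Aᵐᵒᵖ M] [SMulCommClass B Aᵐᵒᵖ M]

open EndBimodule

/-- In `M^* ⊗_B S / I`, an `x ∈ I ⊆ B` gives `f x ⊗ 1 = f ⊗ x = 0`. As the `f x` generate `M^*`, the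
class of `1` is killed by all of `M^*`, so it vanishes. -/
theorem one_mem_of_rightFaithfullyFlat
    (h : RightFaithfullyFlat.{u, max v w} B (RightDual A M))
    {I : SubBimodule (endExtension B A M)}
    (hI : ∀ z ∈ I, z ∈ (1 : SubBimodule (endExtension B A M))) (hd : dualMul I = ⊤) :
    (1 : Module.End Aᵐᵒᵖ M) ∈ I := by
  refine (Submodule.Quotient.mk_eq_zero I.toLeft).1
    (RightFaithfullyFlat.eq_zero.{u, v, w} h (z := I.toLeft.mkQ 1) fun f => ?_)
  have h1 : dualMul I ≤ ((TensorOver.tmulHom B _ _).flip (I.toLeft.mkQ 1)).ker := by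
    refine (AddSubgroup.closure_le _).2 ?_
    rintro _ ⟨f, x, hx, rfl⟩
    obtain ⟨b, rfl⟩ := hI x hx
    refine (TensorOver.balanced f b (I.toLeft.mkQ 1)).trans ?_
    rw [← map_smul, smul_def, mul_one]
    convert TensorOver.tmul_zero f
    exact (Submodule.Quotient.mk_eq_zero I.toLeft).2 hx
  exact h1 (hd ▸ AddSubgroup.mem_top f)

theorem one_mem_of_leftFaithfullyFlat (h : LeftFaithfullyFlat B M)
    {I : SubBimodule (endExtension B A M)}
    (hI : ∀ z ∈ I, z ∈ (1 : SubBimodule (endExtension B A M))) (hd : mulVec I = ⊤) :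
    (1 : Module.End Aᵐᵒᵖ M) ∈ I := by
  refine (Submodule.Quotient.mk_eq_zero I.toRight).1
    (LeftFaithfullyFlat.eq_zero h (z := I.toRight.mkQ 1) fun u => ?_)
  have h1 : mulVec I ≤ (TensorOver.tmulHom B _ _ (I.toRight.mkQ 1)).ker := by
    refine (AddSubgroup.closure_le _).2 ?_
    rintro _ ⟨x, hx, u, rfl⟩
    obtain ⟨b, rfl⟩ := hI x hx
    refine (TensorOver.balanced (I.toRight.mkQ 1) b u).symm.trans ?_
    rw [← map_smul, op_smul_def, one_mul]
    convert TensorOver.zero_tmul u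
    exact (Submodule.Quotient.mk_eq_zero I.toRight).2 hx
  exact h1 (hd ▸ AddSubgroup.mem_top u)

variable [Module.Finite Aᵐᵒᵖ M] [Module.Projective Aᵐᵒᵖ M]

/-- From `f z ⊗ u = f ⊗ z(u)` one gets `f z ⊗ 1 = f ⊗ z` in `M^* ⊗_B S`. Modulo `B` the left side is
zero, so the class of `z` in `S / B` is killed by `M^*`. -/
theorem mem_one_of_rightFaithfullyFlat
    (h : RightFaithfullyFlat.{u, max v w} B (RightDual A M)) (z : Module.End Aᵐᵒᵖ M)
    (hz : z ∈ twist (1 : CoringEnd A (Comatrix B A M))) :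
    z ∈ (1 : SubBimodule (endExtension B A M)) := by
  obtain ⟨D⟩ := nonempty_dualBasis A M
  let K := (1 : SubBimodule (endExtension B A M)).toLeft
  let z' : EndBimodule B A M := z
  refine (Submodule.Quotient.mk_eq_zero K).1
    (RightFaithfullyFlat.eq_zero.{u, v, w} h (z := K.mkQ z') fun f => ?_)
  have h1 : TensorOver.tmul B f z' = TensorOver.tmul B (f.comp z) (1 : EndBimodule B A M) := by
    rw [tmul_eq_sum_right D, tmul_eq_sum_right D]
    exact Finset.sum_congr rfl fun j _ => congrArg _ (hz f (D.vec j)).symm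
  have h2 := congrArg (TensorOver.map LinearMap.id K.mkQ) h1
  rw [TensorOver.map_tmul, TensorOver.map_tmul] at h2
  exact h2.trans ((congrArg (TensorOver.tmul B (f.comp z))
    ((Submodule.Quotient.mk_eq_zero K).2 one_mem_one)).trans (TensorOver.tmul_zero _))

theorem mem_one_of_leftFaithfullyFlat (h : LeftFaithfullyFlat B M) (z : Module.End Aᵐᵒᵖ M)
    (hz : z ∈ twist (1 : CoringEnd A (Comatrix B A M))) :
    z ∈ (1 : SubBimodule (endExtension B A M)) := by
  obtain ⟨D⟩ := nonempty_dualBasis A M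
  let K := (1 : SubBimodule (endExtension B A M)).toRight
  let z' : EndBimodule B A M := z
  refine (Submodule.Quotient.mk_eq_zero K).1
    (LeftFaithfullyFlat.eq_zero h (z := K.mkQ z') fun u => ?_)
  have h1 : TensorOver.tmul B z' u = TensorOver.tmul B (1 : EndBimodule B A M) (z u) := by
    rw [tmul_eq_sum_left D, tmul_eq_sum_left D]
    exact Finset.sum_congr rfl fun i _ => congrArg _ (hz (D.covec i) u)
  have h2 := congrArg (TensorOver.map K.mkQ LinearMap.id) h1
  rw [TensorOver.map_tmul, TensorOver.map_tmul] at h2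
  exact h2.trans ((congrArg (TensorOver.tmul B · (z u))
    ((Submodule.Quotient.mk_eq_zero K).2 one_mem_one)).trans (TensorOver.zero_tmul _))

/-- Only flatness enters: the injection of `S / ker d` into `S ⊗_B S` stays injective under `M^* ⊗_B
-`, so `f w` dies in `M^* ⊗_B S / ker d` and its product `f` lies in `M^* · ker d`. -/
theorem dualMul_twist_of_rightFaithfullyFlat
    (h : RightFaithfullyFlat.{u, max v w} B (RightDual A M))
    (φ : CoringEnd A (Comatrix B A M)) : dualMul (twist φ) = ⊤ := by
  obtain ⟨D⟩ := nonempty_dualBasis A M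
  refine top_le_iff.1 fun f _ => ?_
  let d := leftDefect D φ.toBimodHom
  rw [← lift_rightCoaction D φ f (dualAct B A M) dualAct_tmul]
  refine dualAct_mem (LinearMap.ker d) _
    (fun f x hx => comp_mem_dualMul f (mem_twist_of_leftDefect D hx)) ?_
  refine RightFaithfullyFlat.map_injective.{u, v, w} h
    ((LinearMap.ker d).liftQ d le_rfl)
    (LinearMap.ker_eq_bot.1 (Submodule.ker_liftQ_eq_bot _ _ _ le_rfl)) ?_
  rw [map_zero, TensorOver.map_map, Submodule.liftQ_mkQ]
  exact map_leftDefect_rightCoaction D φ f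

/-- The mirror argument applies to `w u` and the right defect, whose kernel lies in the twist of the
inverse; this is why `φ` is taken invertible here. -/
theorem mulVec_twist_of_leftFaithfullyFlat (h : LeftFaithfullyFlat B M)
    (φ : CoringAut A (Comatrix B A M)) :
    mulVec (twist (φ⁻¹ : CoringAut A (Comatrix B A M)).1) = ⊤ := by
  obtain ⟨D⟩ := nonempty_dualBasis A M
  refine top_le_iff.1 fun u _ => ?_
  let d := rightDefect D φ.1.toBimodHom
  rw [← lift_leftCoaction D φ.1 u (vecAct B A M) vecAct_tmul]
  refine vecAct_mem (LinearMap.ker d) _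
    (fun x hx v => apply_mem_mulVec (mem_twist_inv_of_rightDefect D hx) v) ?_
  refine LeftFaithfullyFlat.map_injective h
    ((LinearMap.ker d).liftQ d le_rfl)
    (LinearMap.ker_eq_bot.1 (Submodule.ker_liftQ_eq_bot _ _ _ le_rfl)) ?_
  rw [map_zero, TensorOver.map_map, Submodule.liftQ_mkQ]
  exact map_rightDefect_leftCoaction D φ.1 u

end RightFlat

/-! ### The separable case -/

section Separable

variable {B A M : Type*} [Ring B] [Ring A] [AddCommGroup M] [Module B M] [Module Aᵐᵒᵖ M]
  [SMulCommClass B Aᵐᵒᵖ M]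

open EndBimodule

/-- For a separable bimodule, `B → S` splits as a map of `B`-bimodules. -/
theorem IsSeparableBimodule.exists_retraction (h : IsSeparableBimodule B A M) :
    ∃ E : EndBimodule B A M →ₗ[Bᵐᵒᵖ] B, (∀ (b : B) s, E (b • s) = b * E s) ∧ E 1 = 1 := by
  obtain ⟨σ, hσ⟩ := h
  let R : EndBimodule B A M → TensorOver A M (LeftDual B M) → TensorOver A M (LeftDual B M) :=
    fun s => TensorOver.map (show M →ₗ[Aᵐᵒᵖ] M from s) (LinearMap.id (M := LeftDual B M))
  have hadd : ∀ s t z, R (s + t) z = R s z + R t z := fun s t z => by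
    induction z using TensorOver.induction with
    | tmul x f => exact TensorOver.add_tmul (s x) (t x) f
    | add x y hx hy => simp only [R, map_add] at *; rw [hx, hy]; abel
  have hleft : ∀ (b : B) s z, R (b • s) z = b • R s z := fun b s z => by
    induction z using TensorOver.induction with
    | tmul x f => rfl
    | add x y hx hy => simp only [R, map_add, smul_add] at *; rw [hx, hy]
  have hmid : ∀ (b : B) s z, R (op b • s) z = R s (b • z) := fun b s z => by
    induction z using TensorOver.induction with
    | tmul x f => rfl
    | add x y hx hy => simp only [R, map_add, smul_add] at *; rw [hx, hy]
  have hright : ∀ (b : B) s z, R s (op b • z) = op b • R s z := fun b s z => by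
    induction z using TensorOver.induction with
    | tmul x f => rfl
    | add x y hx hy => simp only [R, map_add, smul_add] at *; rw [hx, hy]
  -- The splitting yields a central element `σ(1)`; the retraction is `E(s) = ev(s σ(1))`, and
  -- centrality makes it right `B`-linear.
  have hcentral : ∀ b : B, b • σ 1 = op b • σ 1 := fun b => by
    refine (σ.map_smul' b 1).symm.trans (Eq.trans ?_ (σ.map_op_smul' b 1))
    simp
  refine ⟨{ toFun := fun s => evaluation B A M (R s (σ 1))
            map_add' := fun s t => by rw [hadd, map_add]
            map_smul' := fun b s => ?_ }, fun b s => ?_, ?_⟩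
  · rw [← MulOpposite.op_unop b, hmid, hcentral, hright]
    exact (evaluation B A M).map_op_smul' _ _
  · change evaluation B A M (R (b • s) (σ 1)) = _
    rw [hleft]
    exact (evaluation B A M).map_smul' _ _
  · change evaluation B A M (TensorOver.map LinearMap.id LinearMap.id (σ 1)) = 1
    rw [TensorOver.map_id, hσ]

variable (E : EndBimodule B A M →ₗ[Bᵐᵒᵖ] B)

/-- For `b ∈ I ⊆ B` one has `E(v (f b)) = E(v f) b ∈ I`. As the `f b` generate `M^*`, all `E(v f)`
lie in `I`, in particular the terms of `∑ E(eᵢ eᵢ^*) = E(1) = 1`. -/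
theorem one_mem_of_retraction (hE1 : E 1 = 1) (D : DualBasis A M) {I : SubBimodule (endExtension B A M)}
    (hI : ∀ z ∈ I, z ∈ (1 : SubBimodule (endExtension B A M))) (hd : dualMul I = ⊤) :
    (1 : Module.End Aᵐᵒᵖ M) ∈ I := by
  have h1 : ∀ v f, endExtension B A M (E (rankOne v f)) ∈ I := fun v f => by
    have h2 : dualMul I ≤ I.toAddSubgroup.comap
        ((endExtension B A M).toAddMonoidHom.comp
          (E.toAddMonoidHom.comp (rankOneLeft v).toAddMonoidHom)) := by
      refine (AddSubgroup.closure_le _).2 ?_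
      rintro _ ⟨f, x, hx, rfl⟩
      obtain ⟨b, rfl⟩ := hI x hx
      change endExtension B A M (E (op b • rankOne v f)) ∈ I
      rw [map_smul, op_smul_eq_mul, map_mul]
      exact I.left_mem _ hx
    exact h2 (hd ▸ AddSubgroup.mem_top f)
  rw [← map_one (endExtension B A M), ← hE1, ← sum_rankOne D, map_sum, map_sum]
  exact sum_mem fun i _ => h1 _ _

/-- The map `S ⊗_B X → X`, `s ⊗ x ↦ E(s) x`. -/
def expect (X : Type*) [AddCommGroup X] [Module B X] : TensorOver B (EndBimodule B A M) X →+ X :=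
  (TensorOver.lid B X).comp (TensorOver.map E LinearMap.id)

@[simp] theorem expect_tmul {X : Type*} [AddCommGroup X] [Module B X] (s : EndBimodule B A M)
    (x : X) : expect E X (TensorOver.tmul B s x) = E s • x := rfl

theorem expect_map {X Y : Type*} [AddCommGroup X] [Module B X] [AddCommGroup Y] [Module B Y]
    (d : X →ₗ[B] Y) (t : TensorOver B (EndBimodule B A M) X) :
    expect E Y (TensorOver.map LinearMap.id d t) = d (expect E X t) := by
  induction t using TensorOver.induction with
  | tmul s x => simp
  | add x y hx hy => simp only [map_add, hx, hy]

variable [Module.Finite Aᵐᵒᵖ M] [Module.Projective Aᵐᵒᵖ M]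

/-- The hypothesis lifts to `z ⊗ 1 = 1 ⊗ z` in `S ⊗_B S`, and applying `E` to the first factor gives
`E(z) = z` in `S`. -/
theorem mem_one_of_retraction (hE1 : E 1 = 1) (z : Module.End Aᵐᵒᵖ M)
    (hz : z ∈ twist (1 : CoringEnd A (Comatrix B A M))) :
    z ∈ (1 : SubBimodule (endExtension B A M)) := by
  obtain ⟨D⟩ := nonempty_dualBasis A M
  let z' : EndBimodule B A M := z
  have h1 : TensorOver.tmul B z' (1 : EndBimodule B A M) = TensorOver.tmul B 1 z' := by
    have h2 : ∀ s t : EndBimodule B A M, TensorOver.tmul B s t = ∑ i, ∑ j,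
        sandwich (D.vec i) (D.covec j)
          (TensorOver.tmul B ((D.covec i).comp s) (t (D.vec j))) := fun s t => by
      conv_lhs => rw [← one_mul s, ← sum_rankOne D, Finset.sum_mul, TensorOver.sum_tmul]
      refine Finset.sum_congr rfl fun i _ => ?_
      conv_lhs => rw [← mul_one t, ← sum_rankOne D, Finset.mul_sum, TensorOver.tmul_sum]
      simp only [mul_rankOne]
      rfl
    rw [h2, h2]
    exact Finset.sum_congr rfl fun i _ => Finset.sum_congr rfl fun j _ =>
      congrArg _ (hz (D.covec i) (D.vec j))
  have h3 := congrArg (expect E _) h1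
  rw [expect_tmul, expect_tmul, hE1, one_smul, smul_def, mul_one] at h3
  exact ⟨E z', h3⟩

/-- With `G = E ⊗ id`, the map `x ↦ G(x w)` takes values in `ker d`, and `id ⊗ G(- w)` fixes `f w`.
Multiplying out, `f` becomes a sum of elements of `M^* · ker d`. -/
theorem dualMul_twist_of_retraction (hE : ∀ (b : B) s, E (b • s) = b * E s) (hE1 : E 1 = 1)
    (φ : CoringEnd A (Comatrix B A M)) : dualMul (twist φ) = ⊤ := by
  obtain ⟨D⟩ := nonempty_dualBasis A M
  let d := leftDefect D φ.toBimodHom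
  let w := canonical D φ.toBimodHom
  let G : TensorOver B (EndBimodule B A M) (EndBimodule B A M) →ₗ[B] EndBimodule B A M :=
    { expect E _ with
      map_smul' := fun b t => by
        change expect E _ (b • t) = b • expect E _ t
        induction t using TensorOver.induction with
        | tmul s x => simp [hE, mul_smul]
        | add x y hx hy => simp only [smul_add, map_add, hx, hy] }
  have hw : TensorOver.map LinearMap.id d w = 0 := by
    change TensorOver.map LinearMap.id d (canonical D φ.toBimodHom) = 0
    rw [← sum_map_rightCoaction, map_sum]
    refine Finset.sum_eq_zero fun i _ => ?_
    rw [TensorOver.map_map, LinearMap.id_comp, LinearMap.comp_id,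
      ← LinearMap.comp_id (rankOneLeft (D.vec i)), ← LinearMap.id_comp d, ← TensorOver.map_map,
      map_leftDefect_rightCoaction, map_zero]
  have hp : ∀ x : EndBimodule B A M, d (G (x • w)) = 0 := fun x => by
    refine (expect_map E d (x • w)).symm.trans ?_
    have h1 : ∀ t : TensorOver B (EndBimodule B A M) (EndBimodule B A M),
        TensorOver.map LinearMap.id d (x • t) = x • TensorOver.map LinearMap.id d t :=
      fun t => by
        induction t using TensorOver.induction with
        | tmul s y => rfl
        | add y z hy hz => simp only [smul_add, map_add, hy, hz]
    rw [h1, hw, smul_zero, map_zero]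
  have hG : G ∘ₗ oneTmul B A M = LinearMap.id := by
    ext1 x
    change E 1 • x = x
    rw [hE1, one_smul]
  refine top_le_iff.1 fun f _ => ?_
  -- Since `G(1 ⊗ x) = x`, applying `id ⊗ G` to the equation for `f w` yields exactly this
  -- fixed-point property.
  have h2 := congrArg (TensorOver.map LinearMap.id G) (map_leftDefect_rightCoaction D φ f)
  rw [leftDefect, TensorOver.map_sub_right, map_sub, map_zero, sub_eq_zero, TensorOver.map_map,
    TensorOver.map_map, hG, LinearMap.id_comp, TensorOver.map_id] at h2
  rw [← lift_rightCoaction D φ f (dualAct B A M) dualAct_tmul, ← h2]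
  generalize rightCoaction D φ.toBimodHom f = t
  induction t using TensorOver.induction with
  | tmul g x => exact comp_mem_dualMul g (mem_twist_of_leftDefect D (hp x))
  | add x y hx hy => rw [map_add, map_add]; exact add_mem hx hy

end Separable

end ComatrixCoring

/-! ### The isomorphism of groups. -/

open ComatrixCoring
theorem mainTheorem1 {B : Type u} {A : Type v} {M : Type w} [Ring B] [Ring A] [AddCommGroup M]
    [Module B M] [Module Aᵐᵒᵖ M] [SMulCommClass B Aᵐᵒᵖ M]
    [FaithfulSMul B M] [Module.Finite Aᵐᵒᵖ M] [Module.Projective Aᵐᵒᵖ M]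
    (h : (LeftFaithfullyFlat B M ∨ RightFaithfullyFlat B (RightDual A M)) ∨
      IsSeparableBimodule B A M) :
    ∃ Γ : InvSubBimodule (endExtension B A M) ≃* CoringAut A (Comatrix B A M),
      ∀ (I : InvSubBimodule (endExtension B A M)) (n : ℕ) (s x : Fin n → Module.End Aᵐᵒᵖ M),
        (∀ k, x k ∈ (I : SubBimodule (endExtension B A M))) → ∑ k, s k * x k = 1 →
          ∀ (f : RightDual A M) (m : M),
            (Γ I : CoringEnd A (Comatrix B A M)) (TensorOver.tmul B f m) =
              ∑ k, TensorOver.tmul B (f.comp (s k)) (x k m) := by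
  have key : Function.Bijective
      (invToAut : InvSubBimodule (endExtension B A M) →* CoringAut A (Comatrix B A M)) := by
    rcases h with (h | h) | h
    · have h1 := mem_one_of_leftFaithfullyFlat (A := A) h
      refine invToAut_bijective h1 fun φ => one_mem_of_leftFaithfullyFlat h
        (fun z hz => twist_inv_mul_le_one h1 φ hz) (mulVec_mul ?_ ?_)
      · exact mulVec_twist_of_leftFaithfullyFlat h φ
      -- The right defect of an automorphism controls the twist of its inverse, so `twist φ` is
      -- reached from `φ⁻¹`.
      · simpa using mulVec_twist_of_leftFaithfullyFlat h φ⁻¹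
    · have h1 := mem_one_of_rightFaithfullyFlat h
      exact invToAut_bijective h1 fun φ => one_mem_of_rightFaithfullyFlat h
        (fun z hz => twist_inv_mul_le_one h1 φ hz)
        (dualMul_mul (dualMul_twist_of_rightFaithfullyFlat h _)
          (dualMul_twist_of_rightFaithfullyFlat h _))
    · obtain ⟨E, hE, hE1⟩ := h.exists_retraction
      obtain ⟨D⟩ := nonempty_dualBasis A M
      have h1 := mem_one_of_retraction E hE1
      exact invToAut_bijective h1 fun φ => one_mem_of_retraction E hE1 D
        (fun z hz => twist_inv_mul_le_one h1 φ hz)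
        (dualMul_mul (dualMul_twist_of_retraction E hE hE1 _)
          (dualMul_twist_of_retraction E hE hE1 _))
  refine ⟨MulEquiv.ofBijective invToAut key, fun I n s x hx hs f m => ?_⟩
  exact invToEnd_tmul I hx hs f m
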